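/- Let $k\ge 1$ be an odd integer, let $\nu\in\mathbb{C}$ with $\Re(\nu)>0$, and let $a,x>0$ and $0<\theta<1$ be real numbers. Then $$ \begin{aligned} &\left(\frac{a^2x}{4}\right)^{\frac{\nu}{2}+k+1}\sum_{n=1}^{\infty} n^{\nu/2}K_\nu(a\sqrt{nx})\sum_{d\mid n}d^k\cos(2\pi d\theta)\\ &=\frac{(-1)^{\frac{k-1}{2}}a^{2k+2}\,k!}{2^{2k+4}(2\pi)^{k+1}}\,\Gamma(\nu)\,\bigl\{\zeta(k+1,\theta)+\zeta(k+1,1-\theta)\bigr\}\,x^{k+1}\\ &\quad+\frac{(-1)^{\frac{k+1}{2}}(2\pi)^{k+1}\,\Gamma(\nu+k+1)}{4}\sum_{d=1}^{\infty}d^k\sum_{m=0}^{\infty}\left\{\frac{1}{\left(\frac{16\pi^2}{a^2}\frac{d(m+\theta)}{x}+1\right)^{\nu+k+1}}+\frac{1}{\left(\frac{16\pi^2}{a^2}\frac{d(m+1-\theta)}{x}+1\right)^{\nu+k+1}}\right\}\\ &\quad-\delta_{k,1}\,\frac{a^2}{16}\,\Gamma(1+\nu)\,x, \end{aligned} $$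 where the series on the left and the double series on the right (over pairs $(d,m)$, the two terms in braces taken together) converge absolutely. Here $\delta_{k,1}=1$ if $k=1$ and $0$ otherwise, and $\zeta(s,\alpha)=\sum_{n\ge0}(n+\alpha)^{-s}$ (for $\Re(s)>1$, $0<\alpha<1$) is the Hurwitz zeta function. All powers are principal, and $K_\nu$ is the modified Bessel function $$K_\nu(z)=\frac{\pi}{2}\,\frac{I_{-\nu}(z)-I_\nu(z)}{\sin \pi\nu}\quad(\nu\notin\mathbb{Z}),\qquad I_\nu(z)=\sum_{n=0}^{\infty}\frac{(z/2)^{\nu+2n}}{n!\,\Gamma(\nu+n+1)},$$ with $K_n(z)=\lim_{\mu\to n}K_\mu(z)$ for $n\in\mathbb{Z}$. -/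

import Mathlib

open Filter Topology

noncomputable section

/-- The modified Bessel function of the first kind,
`I_ν(z) = ∑_{n ≥ 0} (z/2)^(ν + 2n) / (n! Γ(ν + n + 1))`, with principal powers.
Mathlib's `Complex.Gamma` vanishes at its poles and `w / 0 = 0`, so the terms in which
`ν + n + 1` is a non-positive integer are `0`, as they should be. -/
def besselI (ν z : ℂ) : ℂ :=
  ∑' n : ℕ, (z / 2) ^ (ν + 2 * (n : ℂ)) / ((n.factorial : ℂ) * Complex.Gamma (ν + n + 1))

/-- The quotient `(π / 2) (I_{-ν}(z) - I_ν(z)) / sin (π ν)`. -/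
def besselKQuotient (ν z : ℂ) : ℂ :=
  (Real.pi : ℂ) / 2 * (besselI (-ν) z - besselI ν z) / Complex.sin (Real.pi * ν)

open Classical in
/-- The modified Bessel function of the second kind `K_ν(z)`: the quotient above when `ν` is not
an integer, and its limit in the order, `K_n(z) = lim_{μ → n} K_μ(z)`, when `ν = n` is an
integer. -/
def besselK (ν z : ℂ) : ℂ :=
  if ∃ n : ℤ, ν = (n : ℂ) then limUnder (𝓝[≠] ν) (fun μ : ℂ => besselKQuotient μ z)
  else besselKQuotient ν z

/-- The weighted divisor sum `∑_{d ∣ n} d^k cos (2π d θ)`. -/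
def cosDivisorSum (k : ℕ) (θ : ℝ) (n : ℕ) : ℝ :=
  ∑ d ∈ n.divisors, (d : ℝ) ^ k * Real.cos (2 * Real.pi * d * θ)

end

/-! Put X = a²x/4. The Bessel function enters through Macdonald's integral, 2 T^ν K_ν(2T) = ∫₀^∞
exp(-t - T²/t) t^(ν-1) dt (`besselK_eq_macdonaldIntegral`). With T² = nX and n = md, the left side
becomes, up to a power of X, a sum over pairs (m, d) of integrals of d^k cos(2πdθ) exp(-t - mdX/t)
t^(ν-1). Under the integral sign stands a Lambert series with parameter w = X/(2πt).

That series has a modular transformation w → 1/w (`lambertSum_eq`). It comes from summing (m i w + n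
+ θ)^(-k-1) over ℤ² in both orders: the rows give Hurwitz zeta values (m = 0) and the Lambert series
(m ≠ 0), the columns give the dual series, each by Lipschitz summation. For k ≥ 2 the lattice sum
converges absolutely. For k = 1 the two orders differ by 2π/w, and this is the source of the δ-term
(`tsum_shiftedEis_comm_one`).

After the transformation the dual exponentials are linear in t, so integrating against exp(-t)
t^(ν-1) leaves only Gamma integrals: Γ(ν) from the zeta values, Γ(ν+1) from the δ-term, and
Γ(ν+k+1)(1+c)^(-ν-k-1) from the dual series (`tsum_macdonaldIntegral_sub`). Grouping pairs by n = md
gives the divisor sum (`hasSum_cosDivisorSum_mul`). -/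

/-! ### Incomplete Gamma functions and the power series of the lower part -/

open MeasureTheory in
theorem integrableOn_exp_neg_mul_rpow_Ioi {T : ℝ} (hT : 0 < T) (σ : ℝ) :
    IntegrableOn (fun t : ℝ => Real.exp (-t) * t ^ σ) (Set.Ioi T) := by
  refine integrable_of_isBigO_exp_neg (b := 1 / 2) (by norm_num) ?_
    (Real.Gamma_integrand_isLittleO σ).isBigO
  refine ContinuousOn.mul (by fun_prop) ?_
  exact continuousOn_id.rpow_const fun t ht => Or.inl (hT.trans_le ht).ne'

theorem continuousOn_ofReal_cpow_Ioi (s : ℂ) :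
    ContinuousOn (fun t : ℝ => (t : ℂ) ^ s) (Set.Ioi 0) := fun t ht =>
  (Complex.continuousAt_ofReal_cpow_const t s (Or.inr (ne_of_gt ht))).continuousWithinAt

theorem norm_ofReal_mul_cpow {r t : ℝ} (hr : 0 ≤ r) (ht : 0 < t) (s : ℂ) :
    ‖(r : ℂ) * (t : ℂ) ^ s‖ = r * t ^ s.re := by
  rw [norm_mul, Complex.norm_cpow_eq_rpow_re_of_pos ht, Complex.norm_real, Real.norm_of_nonneg hr]

open MeasureTheory in
theorem integrableOn_exp_neg_mul_cpow_Ioi {T : ℝ} (hT : 0 < T) (s : ℂ) :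
    IntegrableOn (fun t : ℝ => ((Real.exp (-t) : ℝ) : ℂ) * (t : ℂ) ^ s) (Set.Ioi T) := by
  refine Integrable.mono' (integrableOn_exp_neg_mul_rpow_Ioi hT s.re) ?_ ?_
  · refine ContinuousOn.aestronglyMeasurable ?_ measurableSet_Ioi
    exact ContinuousOn.mul (by fun_prop)
      ((continuousOn_ofReal_cpow_Ioi s).mono (Set.Ioi_subset_Ioi hT.le))
  · refine (ae_restrict_iff' measurableSet_Ioi).2 (.of_forall fun t ht => ?_)
    rw [norm_ofReal_mul_cpow (Real.exp_pos _).le (hT.trans ht)]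

/-- The upper incomplete Gamma function. -/
noncomputable def upperGamma (s : ℂ) (T : ℝ) : ℂ :=
  ∫ t in Set.Ioi T, ((Real.exp (-t) : ℝ) : ℂ) * (t : ℂ) ^ (s - 1)

theorem cpow_add_natCast {z : ℂ} (hz : z ≠ 0) (s : ℂ) (n : ℕ) : z ^ (s + n) = z ^ s * z ^ n := by
  rw [Complex.cpow_add _ _ hz, Complex.cpow_natCast]

theorem hasDerivAt_ofReal_cpow {t : ℝ} (ht : 0 < t) (s : ℂ) :
    HasDerivAt (fun t : ℝ => (t : ℂ) ^ s) (s * (t : ℂ) ^ (s - 1)) t := by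
  simpa using ((hasDerivAt_id (t : ℂ)).cpow_const (c := s)
    (Complex.ofReal_mem_slitPlane.2 ht)).comp_ofReal

-- Integration by parts. Since T > 0 there is no singularity, so it holds for every s and can carry
-- the lower Gamma series to the left of Re s = 0.
open MeasureTheory in
theorem mul_upperGamma (s : ℂ) {T : ℝ} (hT : 0 < T) :
    s * upperGamma s T = upperGamma (s + 1) T - ((Real.exp (-T) : ℝ) : ℂ) * (T : ℂ) ^ s := by
  have hd : ∀ t ∈ Set.Ioi T, HasDerivAt (fun t : ℝ => ((Real.exp (-t) : ℝ) : ℂ) * (t : ℂ) ^ s)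
      (s * (((Real.exp (-t) : ℝ) : ℂ) * (t : ℂ) ^ (s - 1)) -
        ((Real.exp (-t) : ℝ) : ℂ) * (t : ℂ) ^ s) t := by
    intro t ht
    have h1 : HasDerivAt (fun t : ℝ => ((Real.exp (-t) : ℝ) : ℂ)) ((-Real.exp (-t) : ℝ) : ℂ) t := by
      refine HasDerivAt.ofReal_comp ?_
      simpa using (hasDerivAt_neg t).exp
    have h2 : HasDerivAt (fun t : ℝ => (t : ℂ) ^ s) (s * (t : ℂ) ^ (s - 1)) t :=
      hasDerivAt_ofReal_cpow (hT.trans ht) s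
    refine (h1.mul h2).congr_deriv ?_
    push_cast
    ring
  have hi := (integrableOn_exp_neg_mul_cpow_Ioi hT (s - 1)).const_mul s
  have hi' := integrableOn_exp_neg_mul_cpow_Ioi hT s
  have hlim : Tendsto (fun t : ℝ => ((Real.exp (-t) : ℝ) : ℂ) * (t : ℂ) ^ s) atTop (𝓝 0) := by
    rw [tendsto_zero_iff_norm_tendsto_zero]
    have h0 : Tendsto (fun t : ℝ => Real.exp (-(1 / 2) * t)) atTop (𝓝 0) :=
      Real.tendsto_exp_atBot.comp (tendsto_id.const_mul_atTop_of_neg (by norm_num))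
    refine ((Real.Gamma_integrand_isLittleO s.re).trans_tendsto h0).congr' ?_
    filter_upwards [eventually_gt_atTop 0] with t ht
    rw [norm_ofReal_mul_cpow (Real.exp_pos _).le ht]
  have hc : ContinuousWithinAt (fun t : ℝ => ((Real.exp (-t) : ℝ) : ℂ) * (t : ℂ) ^ s)
      (Set.Ici T) T := by
    refine ContinuousAt.continuousWithinAt (ContinuousAt.mul (by fun_prop) ?_)
    exact Complex.continuousAt_ofReal_cpow_const T s (Or.inr hT.ne')
  have := integral_Ioi_of_hasDerivAt_of_tendsto hc hd (hi.sub hi') hlim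
  rw [integral_sub hi hi', integral_const_mul] at this
  unfold upperGamma
  rw [add_sub_cancel_right]
  linear_combination this

-- Expand exp(-t) on (0, T] and integrate term by term, dominated by t^(Re s - 1) T^j / j!.
open MeasureTheory in
theorem hasSum_lowerGamma_of_pos {s : ℂ} (hs : 0 < s.re) {T : ℝ} (hT : 0 < T) :
    HasSum (fun j : ℕ => (-1) ^ j * (T : ℂ) ^ (s + j) / ((j.factorial : ℂ) * (s + j)))
      (Complex.Gamma s - upperGamma s T) := by
  have hsplit : Complex.Gamma s - upperGamma s T =
      ∫ t in (0 : ℝ)..T, ((Real.exp (-t) : ℝ) : ℂ) * (t : ℂ) ^ (s - 1) := by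
    rw [Complex.Gamma_eq_integral hs, Complex.GammaIntegral, upperGamma, sub_eq_iff_eq_add]
    have hi := Complex.GammaIntegral_convergent hs
    rw [intervalIntegral.integral_of_le hT.le, ← Set.Ioc_union_Ioi_eq_Ioi hT.le,
      setIntegral_union (Set.Ioc_disjoint_Ioi le_rfl) measurableSet_Ioi
        (hi.mono_set Set.Ioc_subset_Ioi_self) (hi.mono_set (Set.Ioi_subset_Ioi hT.le))]
  have hterm : ∀ j : ℕ, (-1) ^ j * (T : ℂ) ^ (s + j) / ((j.factorial : ℂ) * (s + j)) =
      ∫ t in (0 : ℝ)..T, (-1) ^ j / (j.factorial : ℂ) * (t : ℂ) ^ (s + j - 1) := by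
    intro j
    have hre : 0 < (s + j).re := by simp; positivity
    have hne : s + j ≠ 0 := fun h => by simp [h] at hre
    rw [intervalIntegral.integral_const_mul, integral_cpow (Or.inl (by
      rw [Complex.sub_re, Complex.one_re]; linarith))]
    rw [sub_add_cancel, Complex.ofReal_zero, Complex.zero_cpow hne, sub_zero]
    field_simp
  rw [hsplit]
  simp_rw [hterm]
  refine intervalIntegral.hasSum_integral_of_dominated_convergence
    (fun j t => t ^ (s.re - 1) * (T ^ j / j.factorial)) ?_ ?_ ?_ ?_ ?_
  · intro j
    rw [Set.uIoc_of_le hT.le]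
    refine ContinuousOn.aestronglyMeasurable ?_ measurableSet_Ioc
    exact continuousOn_const.mul
      ((continuousOn_ofReal_cpow_Ioi _).mono Set.Ioc_subset_Ioi_self)
  · refine fun j => .of_forall fun t ht => ?_
    rw [Set.uIoc_of_le hT.le] at ht
    rw [norm_mul, Complex.norm_cpow_eq_rpow_re_of_pos ht.1, norm_div, norm_pow, norm_neg, norm_one,
      one_pow, Complex.norm_natCast]
    have : (s + j - 1).re = (s.re - 1) + (j : ℕ) := by simp; ring
    rw [this, Real.rpow_add_natCast ht.1.ne']
    have h1 : t ^ j ≤ T ^ j := pow_le_pow_left₀ ht.1.le ht.2 j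
    have h2 : 0 < t ^ (s.re - 1) := Real.rpow_pos_of_pos ht.1 _
    calc 1 / (j.factorial : ℝ) * (t ^ (s.re - 1) * t ^ j)
        = t ^ (s.re - 1) * (t ^ j / j.factorial) := by ring
      _ ≤ _ := by gcongr
  · exact .of_forall fun t _ => (Real.summable_pow_div_factorial T).mul_left _
  · simp_rw [tsum_mul_left]
    exact (intervalIntegral.intervalIntegrable_rpow' (by linarith)).mul_const _
  · refine .of_forall fun t ht => ?_
    rw [Set.uIoc_of_le hT.le] at ht
    have h := (NormedSpace.expSeries_div_hasSum_exp (-(t : ℂ))).mul_right ((t : ℂ) ^ (s - 1))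
    rw [← Complex.exp_eq_exp_ℂ] at h
    push_cast
    refine h.congr_fun ?_
    intro j
    have : s + j - 1 = (s - 1) + (j : ℕ) := by ring
    rw [this, cpow_add_natCast (by exact_mod_cast ht.1.ne' : (t : ℂ) ≠ 0), neg_pow]
    ring

/-- Continuation by the functional equation: both sides obey the same recursion from s + 1 to s, and
finitely many steps reach Re s > 0. -/
theorem hasSum_lowerGamma {s : ℂ} (hs : ∀ n : ℕ, s ≠ -n) {T : ℝ} (hT : 0 < T) :
    HasSum (fun j : ℕ => (-1) ^ j * (T : ℂ) ^ (s + j) / ((j.factorial : ℂ) * (s + j)))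
      (Complex.Gamma s - upperGamma s T) := by
  have hT' : (T : ℂ) ≠ 0 := by exact_mod_cast hT.ne'
  obtain ⟨n, hn⟩ := exists_nat_gt (-s.re)
  induction n generalizing s with
  | zero => exact hasSum_lowerGamma_of_pos (by simpa using hn) hT
  | succ n ih =>
    have hs0 : s ≠ 0 := by simpa using hs 0
    have hs1 : ∀ m : ℕ, s + 1 ≠ -m := fun m h => hs (m + 1) (by
      push_cast; linear_combination h)
    have h1 := ih hs1 (by push_cast at hn; simp; linarith)
    have hc : HasSum (fun j : ℕ => (-1) ^ j * (T : ℂ) ^ (s + j) / (j.factorial : ℂ))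
        (((Real.exp (-T) : ℝ) : ℂ) * (T : ℂ) ^ s) := by
      have h := (NormedSpace.expSeries_div_hasSum_exp (-(T : ℂ))).mul_right ((T : ℂ) ^ s)
      rw [← Complex.exp_eq_exp_ℂ] at h
      push_cast
      refine h.congr_fun ?_
      intro j
      rw [cpow_add_natCast hT', neg_pow]
      ring
    -- Use s/(s+j) = 1 - j/(s+j). The factor j removes the term j = 0 and lowers j! to (j-1)!, so
    -- the shifted series is minus the one for s + 1.
    have hh : HasSum (fun j : ℕ => (j : ℂ) * ((-1) ^ j * (T : ℂ) ^ (s + j) /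
        ((j.factorial : ℂ) * (s + j)))) (-(Complex.Gamma (s + 1) - upperGamma (s + 1) T)) := by
      rw [← hasSum_nat_add_iff' 1]
      simp only [Finset.range_one, Finset.sum_singleton, Nat.cast_zero, zero_mul, sub_zero]
      refine h1.neg.congr_fun ?_
      intro j
      have h2 : s + 1 + j ≠ 0 := fun h => hs1 j (by linear_combination h)
      have h3 : s + ((j + 1 : ℕ) : ℂ) = s + 1 + j := by push_cast; ring
      have h4 : ((j : ℂ) + 1) ≠ 0 := by exact_mod_cast j.succ_ne_zero
      have h5 : (j.factorial : ℂ) ≠ 0 := by exact_mod_cast j.factorial_ne_zero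
      rw [h3, Nat.factorial_succ]
      push_cast
      field_simp
      ring
    have h := (hc.sub hh).mul_left s⁻¹
    have e : s⁻¹ * (((Real.exp (-T) : ℝ) : ℂ) * (T : ℂ) ^ s -
        -(Complex.Gamma (s + 1) - upperGamma (s + 1) T)) = Complex.Gamma s - upperGamma s T := by
      have h6 := mul_upperGamma s hT
      rw [Complex.Gamma_add_one s hs0]
      field_simp
      linear_combination h6
    rw [e] at h
    refine h.congr_fun ?_
    intro j
    have h2 : s + j ≠ 0 := fun h => hs j (by linear_combination h)
    have h5 : (j.factorial : ℂ) ≠ 0 := by exact_mod_cast j.factorial_ne_zero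
    field_simp
    ring

/-! ### Macdonald's integral for the Bessel function `besselK` -/

theorem ofReal_cpow_eq_exp {r : ℝ} (hr : 0 < r) (s : ℂ) :
    (r : ℂ) ^ s = Complex.exp (Real.log r * s) := by
  rw [Complex.cpow_def_of_ne_zero (by exact_mod_cast hr.ne'), Complex.ofReal_log hr.le]

theorem exp_neg_le_factorial_div_pow {x : ℝ} (hx : 0 < x) (p : ℕ) :
    Real.exp (-x) ≤ p.factorial / x ^ p := by
  have h := Real.pow_div_factorial_le_exp x hx.le p
  have h0 : (0 : ℝ) < p.factorial := by exact_mod_cast p.factorial_pos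
  rw [Real.exp_neg, inv_le_comm₀ (Real.exp_pos x) (by positivity)]
  rwa [inv_div]

-- Near 0 the factor exp(-y/t) ≤ p! (t/y)^p absorbs any negative power of t, so σ is unrestricted.
open MeasureTheory in
theorem integrableOn_exp_neg_sub_div_mul_rpow {y : ℝ} (hy : 0 < y) (σ : ℝ) :
    IntegrableOn (fun t : ℝ => Real.exp (-t - y / t) * t ^ σ) (Set.Ioi 0) := by
  obtain ⟨p, hp⟩ := exists_nat_gt (-σ)
  have hg := (Real.GammaIntegral_convergent (s := σ + p + 1) (by linarith)).const_mul
    (p.factorial / y ^ p : ℝ)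
  refine Integrable.mono' hg ?_ ?_
  · refine ContinuousOn.aestronglyMeasurable ?_ measurableSet_Ioi
    refine ContinuousOn.mul (Real.continuous_exp.comp_continuousOn (.sub (by fun_prop)
      (continuousOn_const.div continuousOn_id fun t ht => ne_of_gt ht))) ?_
    exact continuousOn_id.rpow_const fun t ht => Or.inl (ne_of_gt ht)
  · refine (ae_restrict_iff' measurableSet_Ioi).2 (.of_forall fun t (ht : 0 < t) => ?_)
    have h1 := exp_neg_le_factorial_div_pow (div_pos hy ht) p
    have h2 : 0 < t ^ σ := Real.rpow_pos_of_pos ht _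
    rw [Real.norm_of_nonneg (by positivity), sub_eq_add_neg, Real.exp_add, add_sub_cancel_right,
      Real.rpow_add_natCast ht.ne']
    calc Real.exp (-t) * Real.exp (-(y / t)) * t ^ σ
        ≤ Real.exp (-t) * (p.factorial / (y / t) ^ p) * t ^ σ := by gcongr
      _ = _ := by rw [div_pow]; field_simp

open MeasureTheory in
theorem integrableOn_exp_neg_sub_div_mul_cpow {y : ℝ} (hy : 0 < y) (s : ℂ) :
    IntegrableOn (fun t : ℝ => ((Real.exp (-t - y / t) : ℝ) : ℂ) * (t : ℂ) ^ s) (Set.Ioi 0) := by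
  refine Integrable.mono' (integrableOn_exp_neg_sub_div_mul_rpow hy s.re) ?_ ?_
  · refine ContinuousOn.aestronglyMeasurable ?_ measurableSet_Ioi
    refine ContinuousOn.mul ?_ (continuousOn_ofReal_cpow_Ioi s)
    refine Complex.continuous_ofReal.comp_continuousOn (Real.continuous_exp.comp_continuousOn
      (.sub (by fun_prop) (continuousOn_const.div continuousOn_id fun t ht => ne_of_gt ht)))
  · refine (ae_restrict_iff' measurableSet_Ioi).2 (.of_forall fun t ht => ?_)
    rw [norm_ofReal_mul_cpow (Real.exp_pos _).le ht]

/-- The integral `∫₀^∞ exp (-t - y / t) t ^ (ν - 1) dt`. -/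
noncomputable def macdonaldIntegral (ν : ℂ) (y : ℝ) : ℂ :=
  ∫ t in Set.Ioi (0 : ℝ), ((Real.exp (-t - y / t) : ℝ) : ℂ) * (t : ℂ) ^ (ν - 1)

/-- The part of `macdonaldIntegral ν (T ^ 2)` over `t > T`. -/
noncomputable def macdonaldTail (ν : ℂ) (T : ℝ) : ℂ :=
  ∫ t in Set.Ioi T, ((Real.exp (-t - T ^ 2 / t) : ℝ) : ℂ) * (t : ℂ) ^ (ν - 1)

-- The involution t ↦ T²/t fixes the exponent -t - T²/t, exchanges (0, T) with (T, ∞), and turns ν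
-- into -ν.
open MeasureTheory in
theorem macdonaldIntegral_eq_tail_add (ν : ℂ) {T : ℝ} (hT : 0 < T) :
    macdonaldIntegral ν (T ^ 2) =
      macdonaldTail ν T + (T : ℂ) ^ (2 * ν) * macdonaldTail (-ν) T := by
  have hi := integrableOn_exp_neg_sub_div_mul_cpow (y := T ^ 2) (by positivity) (ν - 1)
  have himg : (fun t : ℝ => T ^ 2 / t) '' Set.Ioi T = Set.Ioo 0 T := by
    ext r
    simp only [Set.mem_image, Set.mem_Ioi, Set.mem_Ioo]
    constructor
    · rintro ⟨t, ht, rfl⟩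
      have h0 : 0 < t := hT.trans ht
      refine ⟨by positivity, ?_⟩
      rw [div_lt_iff₀ h0]
      nlinarith
    · rintro ⟨h0, h1⟩
      refine ⟨T ^ 2 / r, ?_, by field_simp⟩
      rw [lt_div_iff₀ h0]
      nlinarith
  have hlow : ∫ t in Set.Ioo 0 T, ((Real.exp (-t - T ^ 2 / t) : ℝ) : ℂ) * (t : ℂ) ^ (ν - 1) =
      (T : ℂ) ^ (2 * ν) * macdonaldTail (-ν) T := by
    rw [← himg, integral_image_eq_integral_abs_deriv_smul (f' := fun t => -(T ^ 2 / t ^ 2))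
      measurableSet_Ioi, macdonaldTail, ← integral_const_mul]
    · refine setIntegral_congr_fun measurableSet_Ioi fun t ht => ?_
      have h0 : 0 < t := hT.trans ht
      have e1 : -(T ^ 2 / t) - T ^ 2 / (T ^ 2 / t) = -t - T ^ 2 / t := by
        field_simp
        ring
      have e2 : ((T ^ 2 / t ^ 2 : ℝ) : ℂ) = Complex.exp (2 * Real.log T - 2 * Real.log t) := by
        have : Real.exp (2 * Real.log T - 2 * Real.log t) = T ^ 2 / t ^ 2 := by
          rw [Real.exp_sub, two_mul, two_mul, Real.exp_add, Real.exp_add, Real.exp_log hT,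
            Real.exp_log h0]
          ring
        rw [← this]
        push_cast
        rfl
      rw [e1, abs_neg, abs_of_pos (by positivity), Complex.real_smul, e2,
        ofReal_cpow_eq_exp (by positivity), ofReal_cpow_eq_exp hT, ofReal_cpow_eq_exp h0,
        Real.log_div (by positivity) h0.ne', Real.log_pow, mul_left_comm, ← Complex.exp_add,
        mul_left_comm, ← Complex.exp_add]
      congr 2
      push_cast
      ring
    · intro t ht
      have h0 : t ≠ 0 := (hT.trans ht).ne'
      have := ((hasDerivAt_inv h0).const_mul (T ^ 2)).hasDerivWithinAt (s := Set.Ioi T)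
      refine (this.congr_deriv (by field_simp))
    · intro t ht t' ht' h
      have h0 : 0 < t := hT.trans ht
      have h0' : 0 < t' := hT.trans ht'
      simp only [] at h
      field_simp at h
      exact h.symm
  rw [macdonaldIntegral, ← Set.Ioc_union_Ioi_eq_Ioi hT.le,
    setIntegral_union (Set.Ioc_disjoint_Ioi le_rfl) measurableSet_Ioi
      (hi.mono_set Set.Ioc_subset_Ioi_self) (hi.mono_set (Set.Ioi_subset_Ioi hT.le)),
    integral_Ioc_eq_integral_Ioo, hlow, add_comm]
  rfl

-- For t > T one has T²/t ≤ T, so the series of exp(-T²/t) is dominated by T^n/n!. This is why the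
-- integral is cut at T.
open MeasureTheory in
theorem hasSum_macdonaldTail (ν : ℂ) {T : ℝ} (hT : 0 < T) :
    HasSum (fun n : ℕ => (-(T : ℂ) ^ 2) ^ n / (n.factorial : ℂ) * upperGamma (ν - n) T)
      (macdonaldTail ν T) := by
  unfold upperGamma
  simp_rw [← integral_const_mul]
  refine hasSum_integral_of_dominated_convergence
    (fun n t => Real.exp (-t) * t ^ (ν.re - 1) * (T ^ n / n.factorial)) ?_ ?_ ?_ ?_ ?_
  · intro n
    exact ((integrableOn_exp_neg_mul_cpow_Ioi hT _).const_mul _).aestronglyMeasurable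
  · refine fun n => (ae_restrict_iff' measurableSet_Ioi).2 (.of_forall fun t ht => ?_)
    have h0 : 0 < t := hT.trans ht
    rw [norm_mul, norm_ofReal_mul_cpow (Real.exp_pos _).le h0, norm_div, norm_pow, norm_neg,
      norm_pow, Complex.norm_natCast, Complex.norm_real, Real.norm_of_nonneg hT.le]
    have e : (ν - n - 1).re = (ν.re - 1) - (n : ℕ) := by simp; ring
    rw [e, Real.rpow_sub_natCast h0.ne']
    have h2 : 0 < t ^ (ν.re - 1) := Real.rpow_pos_of_pos h0 _
    have h3 : T ^ 2 / t ≤ T := by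
      rw [div_le_iff₀ h0]
      have : T < t := ht
      nlinarith
    calc (T ^ 2) ^ n / n.factorial * (Real.exp (-t) * (t ^ (ν.re - 1) / t ^ n))
        = Real.exp (-t) * t ^ (ν.re - 1) * ((T ^ 2 / t) ^ n / n.factorial) := by
          rw [div_pow]; ring
      _ ≤ _ := by gcongr
  · exact .of_forall fun t => (Real.summable_pow_div_factorial T).mul_left _
  · simp_rw [tsum_mul_left]
    exact (integrableOn_exp_neg_mul_rpow_Ioi hT _).mul_const _
  · refine (ae_restrict_iff' measurableSet_Ioi).2 (.of_forall fun t ht => ?_)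
    have h0 : 0 < t := hT.trans ht
    have h := (NormedSpace.expSeries_div_hasSum_exp (-(T : ℂ) ^ 2 / t)).mul_right
      (((Real.exp (-t) : ℝ) : ℂ) * (t : ℂ) ^ (ν - 1))
    rw [← Complex.exp_eq_exp_ℂ] at h
    have e : Complex.exp (-(T : ℂ) ^ 2 / t) * (((Real.exp (-t) : ℝ) : ℂ) * (t : ℂ) ^ (ν - 1)) =
        ((Real.exp (-t - T ^ 2 / t) : ℝ) : ℂ) * (t : ℂ) ^ (ν - 1) := by
      rw [← mul_assoc, Complex.ofReal_exp, Complex.ofReal_exp, ← Complex.exp_add]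
      congr 2
      push_cast
      ring
    rw [e] at h
    refine h.congr_fun ?_
    intro n
    have h0' : (t : ℂ) ≠ 0 := by exact_mod_cast h0.ne'
    have e2 : (t : ℂ) ^ (ν - 1) = (t : ℂ) ^ (ν - n - 1) * (t : ℂ) ^ n := by
      rw [← cpow_add_natCast h0']
      congr 1
      ring
    rw [e2, div_pow]
    field_simp

/-- The terms of the double series by which `macdonaldTail ν T` differs from a multiple of
`besselI (-ν) (2 * T)`. -/
noncomputable def macdonaldDouble (ν : ℂ) (T : ℝ) (p : ℕ × ℕ) : ℂ :=
  (T : ℂ) ^ ν * ((-(T : ℂ)) ^ (p.1 + p.2) /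
    ((p.1.factorial : ℂ) * (p.2.factorial : ℂ) * (ν - p.1 + p.2)))

/-- ℤ is closed in ℂ, so ν lies at positive distance from it. -/
theorem exists_bound_inv_sub_int {ν : ℂ} (hν : ∀ n : ℤ, ν ≠ n) :
    ∃ C : ℝ, 0 < C ∧ ∀ n : ℤ, ‖(ν - n)⁻¹‖ ≤ C := by
  have hcl : IsClosed (Set.range ((↑) : ℤ → ℂ)) := Complex.isClosed_range_intCast
  have hpos := (hcl.notMem_iff_infDist_pos (x := ν) (Set.range_nonempty _)).1
    (by rintro ⟨n, hn⟩; exact hν n hn.symm)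
  refine ⟨(Metric.infDist ν (Set.range ((↑) : ℤ → ℂ)))⁻¹, inv_pos.2 hpos, fun n => ?_⟩
  rw [norm_inv]
  refine inv_anti₀ hpos ?_
  rw [← dist_eq_norm]
  exact Metric.infDist_le_dist_of_mem ⟨n, rfl⟩

theorem summable_macdonaldDouble {ν : ℂ} (hν : ∀ n : ℤ, ν ≠ n) (T : ℝ) :
    Summable (macdonaldDouble ν T) := by
  obtain ⟨C, hC, hb⟩ := exists_bound_inv_sub_int hν
  have h1 := Real.summable_pow_div_factorial |T|
  have h2 := (h1.mul_of_nonneg h1 (fun n => by positivity) (fun n => by positivity)).mul_left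
    (‖(T : ℂ) ^ ν‖ * C)
  refine Summable.of_norm_bounded h2 fun p => ?_
  have h3 := hb ((p.1 : ℤ) - p.2)
  have e : macdonaldDouble ν T p = (T : ℂ) ^ ν * (ν - ((p.1 : ℤ) - p.2 : ℤ))⁻¹ *
      ((-(T : ℂ)) ^ p.1 / (p.1.factorial : ℂ) * ((-(T : ℂ)) ^ p.2 / (p.2.factorial : ℂ))) := by
    rw [macdonaldDouble, pow_add]
    push_cast
    rw [← sub_add]
    simp only [div_eq_mul_inv, mul_inv]
    ring
  rw [e, norm_mul, norm_mul]
  simp only [norm_mul, norm_div, norm_pow, norm_neg, Complex.norm_real, Complex.norm_natCast,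
    Real.norm_eq_abs]
  gcongr

/-- This antisymmetry makes the double series for ν and -ν cancel, leaving only the two tails. -/
theorem mul_macdonaldDouble_neg (ν : ℂ) {T : ℝ} (hT : 0 < T) (p : ℕ × ℕ) :
    (T : ℂ) ^ (2 * ν) * macdonaldDouble (-ν) T p = -macdonaldDouble ν T p.swap := by
  have hT' : (T : ℂ) ≠ 0 := by exact_mod_cast hT.ne'
  have e : (T : ℂ) ^ (2 * ν) * (T : ℂ) ^ (-ν) = (T : ℂ) ^ ν := by
    rw [← Complex.cpow_add _ _ hT']
    congr 1
    ring
  have e2 : -ν - p.1 + p.2 = -(ν - p.2 + p.1) := by ring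
  rw [macdonaldDouble, macdonaldDouble, ← mul_assoc, e, e2, Prod.fst_swap, Prod.snd_swap,
    add_comm p.2, mul_comm (p.2.factorial : ℂ), mul_neg, div_neg, mul_neg]

/-- Split each Γ(ν - n) at T: the upper parts sum to the tail, the lower parts expand into the rows
of the double series. -/
theorem hasSum_Gamma_sub_nat {ν : ℂ} (hν : ∀ n : ℤ, ν ≠ n) {T : ℝ} (hT : 0 < T) :
    HasSum (fun n : ℕ => (-(T : ℂ) ^ 2) ^ n / (n.factorial : ℂ) * Complex.Gamma (ν - n))
      (macdonaldTail ν T + ∑' p, macdonaldDouble ν T p) := by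
  have hT' : (T : ℂ) ≠ 0 := by exact_mod_cast hT.ne'
  have h1 : ∀ n : ℕ, HasSum (fun j : ℕ => macdonaldDouble ν T (n, j))
      ((-(T : ℂ) ^ 2) ^ n / (n.factorial : ℂ) *
        (Complex.Gamma (ν - n) - upperGamma (ν - n) T)) := by
    intro n
    have hn : ∀ m : ℕ, ν - n ≠ -m := fun m h => hν (n - m) (by
      push_cast; linear_combination h)
    refine ((hasSum_lowerGamma hn hT).mul_left _).congr_fun fun j => ?_
    have e : (T : ℂ) ^ (ν - n + j) * (T : ℂ) ^ n = (T : ℂ) ^ ν * (T : ℂ) ^ j := by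
      rw [← cpow_add_natCast hT', ← cpow_add_natCast hT']
      congr 1
      ring
    have e2 : (-(T : ℂ) ^ 2) ^ n = (-(T : ℂ)) ^ n * (T : ℂ) ^ n := by
      rw [← mul_pow]; congr 1; ring
    simp only [macdonaldDouble]
    rw [pow_add, neg_pow (T : ℂ) j, e2]
    simp only [div_eq_mul_inv, mul_inv]
    linear_combination (-(-(T : ℂ)) ^ n * (-1) ^ j * ((n.factorial : ℂ))⁻¹ *
      ((j.factorial : ℂ))⁻¹ * (ν - n + j)⁻¹) * e
  have h2 := (summable_macdonaldDouble hν T).hasSum.prod_fiberwise h1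
  refine ((hasSum_macdonaldTail ν hT).add h2).congr_fun fun n => ?_
  ring

theorem sin_pi_mul_ne_zero_of_forall_ne_int {ν : ℂ} (hν : ∀ n : ℤ, ν ≠ n) : Complex.sin (Real.pi * ν) ≠ 0 := by
  rw [Ne, Complex.sin_eq_zero_iff]
  rintro ⟨n, hn⟩
  have : (Real.pi : ℂ) ≠ 0 := by exact_mod_cast Real.pi_ne_zero
  exact hν n (mul_left_cancel₀ this (by rw [hn]; ring))

/-- The reflection formula trades 1/Γ(-ν+n+1) for (-1)^n Γ(ν-n) sin(πν)/π, turning the Bessel series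
into the Gamma series above. -/
theorem mul_besselI_neg {ν : ℂ} (hν : ∀ n : ℤ, ν ≠ n) {T : ℝ} (hT : 0 < T) :
    Real.pi / Complex.sin (Real.pi * ν) * ((T : ℂ) ^ ν * besselI (-ν) ((2 * T : ℝ) : ℂ)) =
      macdonaldTail ν T + ∑' p, macdonaldDouble ν T p := by
  have hT' : (T : ℂ) ≠ 0 := by exact_mod_cast hT.ne'
  have hs := sin_pi_mul_ne_zero_of_forall_ne_int hν
  have hpi : (Real.pi : ℂ) ≠ 0 := by exact_mod_cast Real.pi_ne_zero
  rw [← (hasSum_Gamma_sub_nat hν hT).tsum_eq, besselI, ← tsum_mul_left, ← tsum_mul_left]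
  refine tsum_congr fun n => ?_
  have hG : Complex.Gamma (-ν + n + 1) ≠ 0 := by
    refine Complex.Gamma_ne_zero fun m h => hν (n + 1 + m) ?_
    push_cast
    linear_combination -h
  have hr := Complex.Gamma_mul_Gamma_one_sub (ν - n)
  have e1 : 1 - (ν - n) = -ν + n + 1 := by ring
  have e2 : Complex.sin (Real.pi * (ν - n)) = (-1) ^ n * Complex.sin (Real.pi * ν) := by
    rw [mul_sub, mul_comm (Real.pi : ℂ) n, Complex.sin_antiperiodic.sub_nat_mul_eq]
  have e3 : ((2 * T : ℝ) : ℂ) / 2 = T := by push_cast; ring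
  have e4 : (T : ℂ) ^ (-ν + 2 * n) = (T : ℂ) ^ (-ν) * (T : ℂ) ^ (2 * n) := by
    rw [← cpow_add_natCast hT']; push_cast; rfl
  have e5 : (T : ℂ) ^ ν * (T : ℂ) ^ (-ν) = 1 := by
    rw [← Complex.cpow_add _ _ hT', add_neg_cancel, Complex.cpow_zero]
  rw [e1, e2] at hr
  have hr' : Complex.Gamma (ν - n) =
      (-1) ^ n * (Real.pi / Complex.sin (Real.pi * ν)) / Complex.Gamma (-ν + n + 1) := by
    rw [eq_div_iff hG, hr]
    have : ((-1 : ℂ) ^ n) * (-1) ^ n = 1 := by rw [← mul_pow]; simp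
    field_simp
    linear_combination -this
  rw [hr', e3, e4, neg_pow, ← pow_mul]
  have : ((-1 : ℂ) ^ n) * (-1) ^ n = 1 := by rw [← mul_pow]; simp
  have h6 : (n.factorial : ℂ) ≠ 0 := by exact_mod_cast n.factorial_ne_zero
  calc _ = Real.pi / Complex.sin (Real.pi * ν) * ((T : ℂ) ^ ν * (T : ℂ) ^ (-ν)) *
        (T : ℂ) ^ (2 * n) / (n.factorial * Complex.Gamma (-ν + n + 1)) := by ring
    _ = Real.pi / Complex.sin (Real.pi * ν) * ((-1) ^ n * (-1) ^ n) *
        (T : ℂ) ^ (2 * n) / (n.factorial * Complex.Gamma (-ν + n + 1)) := by rw [e5, this]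
    _ = _ := by
      simp only [div_eq_mul_inv, mul_inv]
      ring

theorem besselKQuotient_eq_macdonaldIntegral {ν : ℂ} (hν : ∀ n : ℤ, ν ≠ n) {T : ℝ} (hT : 0 < T) :
    besselKQuotient ν ((2 * T : ℝ) : ℂ) =
      (T : ℂ) ^ (-ν) / 2 * macdonaldIntegral ν (T ^ 2) := by
  have hT' : (T : ℂ) ≠ 0 := by exact_mod_cast hT.ne'
  have hν' : ∀ n : ℤ, -ν ≠ n := fun n h => hν (-n) (by push_cast; linear_combination -h)
  have h1 := mul_besselI_neg hν hT
  have h2 := mul_besselI_neg hν' hT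
  have h3 : (T : ℂ) ^ (2 * ν) * ∑' p, macdonaldDouble (-ν) T p =
      -∑' p, macdonaldDouble ν T p := by
    rw [← tsum_mul_left, ← tsum_neg]
    simp_rw [mul_macdonaldDouble_neg ν hT]
    exact (Equiv.prodComm ℕ ℕ).tsum_eq fun p => -macdonaldDouble ν T p
  rw [neg_neg, mul_neg, Complex.sin_neg] at h2
  have e5 : (T : ℂ) ^ ν * (T : ℂ) ^ (-ν) = 1 := by
    rw [← Complex.cpow_add _ _ hT', add_neg_cancel, Complex.cpow_zero]
  have e6 : (T : ℂ) ^ (2 * ν) = (T : ℂ) ^ ν * (T : ℂ) ^ ν := by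
    rw [← Complex.cpow_add _ _ hT', two_mul]
  have hs := sin_pi_mul_ne_zero_of_forall_ne_int hν
  rw [besselKQuotient, macdonaldIntegral_eq_tail_add ν hT]
  have h4 : macdonaldTail ν T + (T : ℂ) ^ (2 * ν) * macdonaldTail (-ν) T =
      (T : ℂ) ^ ν * (Real.pi / Complex.sin (Real.pi * ν) *
        (besselI (-ν) ((2 * T : ℝ) : ℂ) - besselI ν ((2 * T : ℝ) : ℂ))) := by
    have h5 : Real.pi / -Complex.sin (Real.pi * ν) = -(Real.pi / Complex.sin (Real.pi * ν)) :=
      div_neg _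
    rw [h5] at h2
    rw [e6] at h3 ⊢
    linear_combination -h1 - (T : ℂ) ^ ν * (T : ℂ) ^ ν * h2 - h3 - (T : ℂ) ^ ν *
      Real.pi / Complex.sin (Real.pi * ν) * besselI ν ((2 * T : ℝ) : ℂ) * e5
  rw [h4]
  linear_combination -(Real.pi / Complex.sin (Real.pi * ν) *
        (besselI (-ν) ((2 * T : ℝ) : ℂ) - besselI ν ((2 * T : ℝ) : ℂ)) / 2) * e5

-- Continuity in the order is what evaluates the limit defining `besselK` at integers. For Re ν
-- within 1 of Re ν₀, t^(Re ν - 1) is at most t^(Re ν₀ - 2) + t^(Re ν₀).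
open MeasureTheory in
theorem continuous_macdonaldIntegral {y : ℝ} (hy : 0 < y) :
    Continuous fun ν => macdonaldIntegral ν y := by
  rw [continuous_iff_continuousAt]
  intro ν₀
  refine continuousAt_of_dominated
    (bound := fun t => Real.exp (-t - y / t) * t ^ (ν₀.re - 2) +
      Real.exp (-t - y / t) * t ^ ν₀.re) ?_ ?_ ?_ ?_
  · exact .of_forall fun ν => (integrableOn_exp_neg_sub_div_mul_cpow hy _).aestronglyMeasurable
  · have hnear : ∀ᶠ ν : ℂ in 𝓝 ν₀, ν.re ∈ Set.Ioo (ν₀.re - 1) (ν₀.re + 1) :=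
      Complex.continuous_re.continuousAt.eventually_mem
        (Ioo_mem_nhds (by linarith) (by linarith))
    filter_upwards [hnear] with ν hν
    refine (ae_restrict_iff' measurableSet_Ioi).2 (.of_forall fun t (ht : 0 < t) => ?_)
    rw [norm_ofReal_mul_cpow (Real.exp_pos _).le ht, ← mul_add]
    refine mul_le_mul_of_nonneg_left ?_ (Real.exp_pos _).le
    have p1 : 0 < t ^ (ν₀.re - 2) := Real.rpow_pos_of_pos ht _
    have p2 : 0 < t ^ ν₀.re := Real.rpow_pos_of_pos ht _
    rw [Complex.sub_re, Complex.one_re]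
    rcases le_total t 1 with h | h
    · have := Real.rpow_le_rpow_of_exponent_ge ht h (show ν₀.re - 2 ≤ ν.re - 1 by linarith [hν.1])
      linarith
    · have := Real.rpow_le_rpow_of_exponent_le h (show ν.re - 1 ≤ ν₀.re by linarith [hν.2])
      linarith
  · exact (integrableOn_exp_neg_sub_div_mul_rpow hy _).add
      (integrableOn_exp_neg_sub_div_mul_rpow hy _)
  · refine (ae_restrict_iff' measurableSet_Ioi).2 (.of_forall fun t (ht : 0 < t) => ?_)
    refine continuousAt_const.mul (ContinuousAt.const_cpow (by fun_prop) (Or.inl ?_))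
    exact_mod_cast ht.ne'

theorem besselK_eq_macdonaldIntegral (ν : ℂ) {T : ℝ} (hT : 0 < T) :
    besselK ν ((2 * T : ℝ) : ℂ) = (T : ℂ) ^ (-ν) / 2 * macdonaldIntegral ν (T ^ 2) := by
  rw [besselK]
  split_ifs with h
  · obtain ⟨n, rfl⟩ := h
    refine Tendsto.limUnder_eq ?_
    have hT' : (T : ℂ) ≠ 0 := by exact_mod_cast hT.ne'
    have hc : Continuous fun μ : ℂ => (T : ℂ) ^ (-μ) / 2 * macdonaldIntegral μ (T ^ 2) := by
      refine Continuous.mul (Continuous.div_const ?_ _)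
        (continuous_macdonaldIntegral (by positivity))
      exact continuous_neg.const_cpow (Or.inl hT')
    refine (hc.continuousAt.tendsto.mono_left nhdsWithin_le_nhds).congr' ?_
    -- Near n, and away from n itself, no order is an integer, so the non-integral formula applies.
    have hcl : IsClosed (Set.range ((↑) : ℤ → ℂ) \ {(n : ℂ)}) := by
      have hd : Set.range ((↑) : ℤ → ℂ) \ {(n : ℂ)} = ((↑) : ℤ → ℂ) '' {n}ᶜ := by
        ext z
        simp only [Set.mem_sdiff, Set.mem_range, Set.mem_singleton_iff, Set.mem_image,
          Set.mem_compl_iff]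
        constructor
        · rintro ⟨⟨m, rfl⟩, hm⟩
          exact ⟨m, by exact_mod_cast hm, rfl⟩
        · rintro ⟨m, hm, rfl⟩
          exact ⟨⟨m, rfl⟩, by exact_mod_cast hm⟩
      rw [hd]
      exact Complex.isClosedEmbedding_intCast.isClosedMap _ (isClosed_discrete _)
    have hmem : (Set.range ((↑) : ℤ → ℂ) \ {(n : ℂ)})ᶜ ∈ 𝓝 (n : ℂ) :=
      hcl.isOpen_compl.mem_nhds (by simp)
    filter_upwards [mem_nhdsWithin_of_mem_nhds hmem, self_mem_nhdsWithin] with μ h1 h2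
    refine (besselKQuotient_eq_macdonaldIntegral (fun m hm => h1 ?_) hT).symm
    exact ⟨⟨m, hm.symm⟩, h2⟩
  · push Not at h
    exact besselKQuotient_eq_macdonaldIntegral h hT

/-! ### Lipschitz summation along rows and columns of the shifted Eisenstein series -/

theorem neg_two_pi_I_pow_succ {k : ℕ} (hk : Odd k) :
    (-2 * Real.pi * Complex.I : ℂ) ^ (k + 1) =
      (-1) ^ ((k + 1) / 2) * (2 * (Real.pi : ℂ)) ^ (k + 1) := by
  obtain ⟨j, rfl⟩ := hk
  have h1 : (2 * j + 1 + 1) / 2 = j + 1 := by omega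
  have h2 : 2 * j + 1 + 1 = 2 * (j + 1) := by ring
  rw [h1, h2, pow_mul, pow_mul, ← mul_pow]
  congr 1
  linear_combination 4 * (Real.pi : ℂ) ^ 2 * Complex.I_sq

theorem I_mul_pow_succ {k : ℕ} (hk : Odd k) (w : ℂ) :
    (Complex.I * w) ^ (k + 1) = (-1) ^ ((k + 1) / 2) * w ^ (k + 1) := by
  obtain ⟨j, rfl⟩ := hk
  have h1 : (2 * j + 1 + 1) / 2 = j + 1 := by omega
  have h2 : 2 * j + 1 + 1 = 2 * (j + 1) := by ring
  rw [h1, h2, pow_mul, pow_mul, ← mul_pow]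
  congr 1
  linear_combination w ^ 2 * Complex.I_sq

/-- The Lipschitz summation formula. -/
theorem tsum_one_div_int_add_pow {k : ℕ} (hk : 1 ≤ k) (β : ℝ) {v : ℝ} (hv : 0 < v) :
    ∑' n : ℤ, 1 / ((n : ℂ) + β + Complex.I * v) ^ (k + 1) =
      (-2 * Real.pi * Complex.I) ^ (k + 1) / (k.factorial : ℂ) *
        ∑' d : ℕ+, ((d : ℕ) : ℂ) ^ k * (Complex.exp (2 * Real.pi * d * β * Complex.I) *
          ((Real.exp (-(2 * Real.pi * v) * (d : ℕ)) : ℝ) : ℂ)) := by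
  have h := EisensteinSeries.qExpansion_identity_pnat hk
    ⟨(β : ℂ) + Complex.I * v, by simpa using hv⟩
  rw [← tsum_congr fun n : ℤ => ?_, h]
  · congr 1
    refine tsum_congr fun d => ?_
    rw [← Complex.exp_nat_mul, Complex.ofReal_exp, ← Complex.exp_add]
    congr 2
    push_cast
    linear_combination (2 * Real.pi * v * (d : ℕ) : ℂ) * Complex.I_sq
  · simp only []
    congr 2
    ring

theorem summable_pnat_pow_mul_exp (k : ℕ) {v : ℝ} (hv : 0 < v) :
    Summable fun d : ℕ+ => ((d : ℕ) : ℝ) ^ k * Real.exp (-v * (d : ℕ)) :=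
  (Real.summable_pow_mul_exp_neg_nat_mul k hv).comp_injective PNat.coe_injective

theorem summable_pnat_pow_mul_exp_mul_exp (k : ℕ) (β : ℝ) {v : ℝ} (hv : 0 < v) :
    Summable fun d : ℕ+ => ((d : ℕ) : ℂ) ^ k *
      (Complex.exp (2 * Real.pi * d * β * Complex.I) *
        ((Real.exp (-v * (d : ℕ)) : ℝ) : ℂ)) := by
  refine Summable.of_norm_bounded (summable_pnat_pow_mul_exp k hv) fun d => ?_
  have : (2 * Real.pi * d * β * Complex.I : ℂ) = ((2 * Real.pi * d * β : ℝ) : ℂ) * Complex.I := by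
    push_cast; rfl
  rw [norm_mul, norm_mul, this, Complex.norm_exp_ofReal_mul_I, norm_pow, Complex.norm_natCast,
    Complex.norm_real, Real.norm_of_nonneg (Real.exp_pos _).le, one_mul]

/-- The summand of a weight `k + 1` Eisenstein series, shifted by the real number `θ`, for the
lattice generated by `1` and `i w`. -/
noncomputable def shiftedEis (k : ℕ) (θ w : ℝ) (m n : ℤ) : ℂ :=
  1 / ((m : ℂ) * (Complex.I * w) + n + θ) ^ (k + 1)

/-- As k + 1 is even, n ↦ -n turns row -m into row m with shift -θ; the characters exp(±2πidθ) then
add up to the cosine. -/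
theorem tsum_shiftedEis_add_tsum_neg {k : ℕ} (hk : Odd k) (θ : ℝ) {w : ℝ} (hw : 0 < w) (m : ℕ+) :
    ∑' n : ℤ, shiftedEis k θ w ((m : ℕ) : ℤ) n + ∑' n : ℤ, shiftedEis k θ w (-((m : ℕ) : ℤ)) n =
      2 * ((-2 * Real.pi * Complex.I) ^ (k + 1) / (k.factorial : ℂ)) *
        ∑' d : ℕ+, ((d : ℕ) : ℂ) ^ k * ((Real.cos (2 * Real.pi * d * θ) : ℝ) : ℂ) *
          ((Real.exp (-(2 * Real.pi * (w * (m : ℕ))) * (d : ℕ)) : ℝ) : ℂ) := by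
  have hm : (0 : ℝ) < (m : ℕ) := by exact_mod_cast m.pos
  have hv : 0 < w * (m : ℕ) := by positivity
  have h1 : ∑' n : ℤ, shiftedEis k θ w ((m : ℕ) : ℤ) n =
      ∑' n : ℤ, 1 / ((n : ℂ) + θ + Complex.I * (w * (m : ℕ) : ℝ)) ^ (k + 1) := by
    refine tsum_congr fun n => ?_
    rw [shiftedEis]
    congr 2
    push_cast
    ring
  have h2 : ∑' n : ℤ, shiftedEis k θ w (-((m : ℕ) : ℤ)) n =
      ∑' n : ℤ, 1 / ((n : ℂ) + (-θ : ℝ) + Complex.I * (w * (m : ℕ) : ℝ)) ^ (k + 1) := by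
    rw [← (Equiv.neg ℤ).tsum_eq]
    refine tsum_congr fun n => ?_
    rw [shiftedEis, ← hk.add_one.neg_pow]
    congr 2
    simp only [Equiv.neg_apply]
    push_cast
    ring
  rw [h1, h2, tsum_one_div_int_add_pow hk.pos θ hv, tsum_one_div_int_add_pow hk.pos (-θ) hv,
    ← mul_add, ← Summable.tsum_add (summable_pnat_pow_mul_exp_mul_exp k θ (by positivity))
    (summable_pnat_pow_mul_exp_mul_exp k (-θ) (by positivity)), mul_comm 2 (_ / _), mul_assoc (_ / _),
    ← tsum_mul_left (a := (2 : ℂ))]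
  congr 1
  refine tsum_congr fun d => ?_
  rw [Complex.ofReal_cos, Complex.cos]
  push_cast
  have e : (2 * Real.pi * d * -θ * Complex.I : ℂ) = -(2 * Real.pi * d * θ) * Complex.I := by ring
  rw [e]
  ring

/-- Pulling out i w leaves a Lipschitz sum with real shift 0 and height b/w. This is where w is
inverted. -/
theorem tsum_shiftedEis_left_of_pos {k : ℕ} (hk : Odd k) {b w : ℝ} (hb : 0 < b) (hw : 0 < w) :
    ∑' m : ℤ, 1 / ((m : ℂ) * (Complex.I * w) + b) ^ (k + 1) =
      (-1) ^ ((k + 1) / 2) / (w : ℂ) ^ (k + 1) *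
      ((-2 * Real.pi * Complex.I) ^ (k + 1) / (k.factorial : ℂ)) *
        ∑' d : ℕ+, ((d : ℕ) : ℂ) ^ k *
          ((Real.exp (-(2 * Real.pi * (b / w)) * (d : ℕ)) : ℝ) : ℂ) := by
  have hw' : (w : ℂ) ≠ 0 := by exact_mod_cast hw.ne'
  have h := tsum_one_div_int_add_pow hk.pos 0 (div_pos hb hw)
  simp only [Complex.ofReal_zero, mul_zero, zero_mul, Complex.exp_zero, one_mul, add_zero] at h
  rw [mul_assoc, ← h, ← tsum_mul_left, ← (Equiv.neg ℤ).tsum_eq]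
  refine tsum_congr fun m => ?_
  have e : ((Equiv.neg ℤ m : ℤ) : ℂ) * (Complex.I * w) + b =
      -((Complex.I * w) * (m + Complex.I * ((b / w : ℝ) : ℂ))) := by
    simp only [Equiv.neg_apply]
    push_cast
    field_simp
    linear_combination (b : ℂ) * Complex.I_sq
  have e1 : ((-1 : ℂ) ^ ((k + 1) / 2)) * (-1) ^ ((k + 1) / 2) = 1 := by rw [← mul_pow]; simp
  have e2 : ((-1 : ℂ) ^ ((k + 1) / 2))⁻¹ = (-1) ^ ((k + 1) / 2) := inv_eq_of_mul_eq_one_left e1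
  rw [e, hk.add_one.neg_pow, mul_pow, I_mul_pow_succ hk]
  simp only [div_eq_mul_inv, mul_inv, e2]
  ring

theorem tsum_shiftedEis_left {k : ℕ} (hk : Odd k) {θ w : ℝ} (hθ : 0 < θ) (hw : 0 < w) (n : ℕ) :
    ∑' m : ℤ, shiftedEis k θ w m n =
      (-1) ^ ((k + 1) / 2) / (w : ℂ) ^ (k + 1) *
      ((-2 * Real.pi * Complex.I) ^ (k + 1) / (k.factorial : ℂ)) *
        ∑' d : ℕ+, ((d : ℕ) : ℂ) ^ k *
          ((Real.exp (-(2 * Real.pi * ((n + θ) / w)) * (d : ℕ)) : ℝ) : ℂ) := by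
  rw [← tsum_shiftedEis_left_of_pos hk (by positivity) hw]
  refine tsum_congr fun m => ?_
  rw [shiftedEis]
  push_cast
  rw [add_assoc]

theorem tsum_shiftedEis_left_neg {k : ℕ} (hk : Odd k) {θ w : ℝ} (hθ : θ < 1) (hw : 0 < w) (n : ℕ) :
    ∑' m : ℤ, shiftedEis k θ w m (-((n : ℤ) + 1)) =
      (-1) ^ ((k + 1) / 2) / (w : ℂ) ^ (k + 1) *
      ((-2 * Real.pi * Complex.I) ^ (k + 1) / (k.factorial : ℂ)) *
        ∑' d : ℕ+, ((d : ℕ) : ℂ) ^ k *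
          ((Real.exp (-(2 * Real.pi * ((n + 1 - θ) / w)) * (d : ℕ)) : ℝ) : ℂ) := by
  have hb : 0 < (n : ℝ) + 1 - θ := by
    have : (0 : ℝ) ≤ n := n.cast_nonneg
    linarith
  rw [← tsum_shiftedEis_left_of_pos hk hb hw, ← (Equiv.neg ℤ).tsum_eq]
  refine tsum_congr fun m => ?_
  rw [shiftedEis, ← hk.add_one.neg_pow]
  congr 2
  simp only [Equiv.neg_apply]
  push_cast
  ring

/-! ### Convergence over the lattice and interchange of the two summations -/

/-- Lattice points other than `0` and `-1` have size at least comparable to the square root of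
`(|m| + 1) (|n| + 1)`, even after a shift by `c ∈ [0, 1]`. -/
theorem exists_lattice_bound {w : ℝ} (hw : 0 < w) :
    ∃ C : ℝ, 0 < C ∧ ∀ c ∈ Set.Icc (0 : ℝ) 1, ∀ m n : ℤ, (m ≠ 0 ∨ (n ≠ 0 ∧ n ≠ -1)) →
      (|(m : ℝ)| + 1) * (|(n : ℝ)| + 1) ≤ C * ‖(m : ℂ) * (Complex.I * w) + n + c‖ ^ 2 := by
  -- The summand 3 serves the row m = 0, the other summand the rows m ≠ 0.
  refine ⟨2 / w * (1 + 2 / w) + 3, by positivity, fun c hc m n hmn => ?_⟩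
  have hnorm : ‖(m : ℂ) * (Complex.I * w) + n + c‖ ^ 2 = |(n : ℝ) + c| ^ 2 + (|(m : ℝ)| * w) ^ 2 := by
    rw [← Complex.normSq_eq_norm_sq, Complex.normSq_apply, mul_pow, sq_abs, sq_abs]
    simp
    ring
  rw [hnorm]
  have hA : |(n : ℝ)| ≤ |(n : ℝ) + c| + 1 := by
    have h1 := abs_sub_abs_le_abs_sub (n : ℝ) (-c)
    rw [sub_neg_eq_add, abs_neg, abs_of_nonneg hc.1] at h1
    linarith [hc.2]
  by_cases hm : m = 0
  · subst hm
    have hn := hmn.resolve_left (by simp)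
    have h1 : 1 ≤ |(n : ℝ) + c| ∧ |(n : ℝ)| + 1 ≤ 3 * |(n : ℝ) + c| := by
      rcases lt_or_ge n 0 with h | h
      · have h2 : n ≤ -2 := by omega
        have h3 : (n : ℝ) ≤ -2 := by exact_mod_cast h2
        rw [abs_of_nonpos (by linarith [hc.2]), abs_of_nonpos (by linarith [hc.2])]
        constructor <;> linarith [hc.2, hc.1]
      · have h2 : 1 ≤ n := by omega
        have h3 : (1 : ℝ) ≤ n := by exact_mod_cast h2
        rw [abs_of_nonneg (by linarith [hc.1]), abs_of_nonneg (by linarith [hc.1])]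
        constructor <;> linarith [hc.2, hc.1]
    have h4 : 0 ≤ 2 / w * (1 + 2 / w) * |(n : ℝ) + c| ^ 2 := by positivity
    simp only [Int.cast_zero, abs_zero, zero_add, zero_mul, one_mul]
    nlinarith
  · have h1 : (1 : ℝ) ≤ |(m : ℝ)| := by
      rw [← Int.cast_abs]; exact_mod_cast Int.one_le_abs hm
    set A := |(n : ℝ) + c| with hAdef
    set B := |(m : ℝ)| * w with hB
    have hBw : w ≤ B := by nlinarith
    have h2 : |(m : ℝ)| + 1 ≤ 2 / w * B := by rw [hB]; field_simp; linarith
    have hA0 : 0 ≤ A := abs_nonneg _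
    have hB0 : 0 ≤ B := by positivity
    have h3 : B ≤ B ^ 2 / w := by rw [le_div_iff₀ hw]; nlinarith
    calc (|(m : ℝ)| + 1) * (|(n : ℝ)| + 1) ≤ (2 / w * B) * (A + 2) := by
          refine mul_le_mul h2 (by linarith) (by positivity) (by positivity)
      _ = 2 / w * (B * A + 2 * B) := by ring
      _ ≤ 2 / w * ((A ^ 2 + B ^ 2) + 2 * ((A ^ 2 + B ^ 2) / w)) := by
          gcongr
          · nlinarith [sq_nonneg (A - B)]
          · refine h3.trans ?_
            gcongr
            nlinarith
      _ ≤ (2 / w * (1 + 2 / w) + 3) * (A ^ 2 + B ^ 2) := by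
          have e : 2 / w * ((A ^ 2 + B ^ 2) + 2 * ((A ^ 2 + B ^ 2) / w)) =
            2 / w * (1 + 2 / w) * (A ^ 2 + B ^ 2) := by ring
          rw [e, add_mul]
          nlinarith [sq_nonneg A, sq_nonneg B]

/-- The weight `√((|m| + 1) (|n| + 1))` on pairs of integers. -/
noncomputable def latticeWeight (p : ℤ × ℤ) : ℝ :=
  √(|(p.1 : ℝ)| + 1) * √(|(p.2 : ℝ)| + 1)

theorem one_le_latticeWeight (p : ℤ × ℤ) : 1 ≤ latticeWeight p :=
  one_le_mul_of_one_le_of_one_le (Real.one_le_sqrt.2 (by linarith [abs_nonneg (p.1 : ℝ)]))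
    (Real.one_le_sqrt.2 (by linarith [abs_nonneg (p.2 : ℝ)]))

theorem summable_int_one_div_sqrt_abs_add_one_pow_three :
    Summable fun n : ℤ => 1 / √(|(n : ℝ)| + 1) ^ 3 := by
  have h : Summable fun n : ℕ => 1 / √((n : ℝ) + 1) ^ 3 := by
    have h1 := (summable_nat_add_iff 1).2 (Real.summable_nat_rpow (p := -(3 / 2)) |>.2 (by norm_num))
    refine h1.congr fun n => ?_
    have h0 : (0 : ℝ) ≤ (n : ℝ) + 1 := by positivity
    rw [Real.sqrt_eq_rpow, ← Real.rpow_natCast, ← Real.rpow_mul h0, one_div, ← Real.rpow_neg h0]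
    push_cast
    norm_num
  exact Summable.of_nat_of_neg (by simpa using h) (by simpa using h)

theorem summable_one_div_latticeWeight_pow_three :
    Summable fun p : ℤ × ℤ => 1 / latticeWeight p ^ 3 := by
  have h := summable_int_one_div_sqrt_abs_add_one_pow_three
  refine (h.mul_of_nonneg h (fun n => by positivity) (fun n => by positivity)).congr fun p => ?_
  rw [latticeWeight, mul_pow]
  simp only [one_div, mul_inv]

/-- The bound is uniform in c, to serve the shifts 0, θ and 1 together. The two excluded points are
those where the linear form vanishes for c = 0 or c = 1. -/
theorem exists_latticeWeight_le_norm {w : ℝ} (hw : 0 < w) :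
    ∃ C : ℝ, 0 < C ∧ ∀ c ∈ Set.Icc (0 : ℝ) 1, ∀ p : ℤ × ℤ, p ≠ (0, 0) → p ≠ (0, -1) →
      C * latticeWeight p ≤ ‖(p.1 : ℂ) * (Complex.I * w) + p.2 + c‖ := by
  obtain ⟨C, hC, h⟩ := exists_lattice_bound hw
  refine ⟨1 / √C, by positivity, fun c hc p h0 h1 => ?_⟩
  have hp : p.1 ≠ 0 ∨ (p.2 ≠ 0 ∧ p.2 ≠ -1) := by
    by_contra! hcon
    obtain ⟨a, b⟩ := p
    simp only at hcon
    obtain ⟨rfl, hb⟩ := hcon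
    by_cases hb0 : b = 0
    · exact h0 (by rw [hb0])
    · exact h1 (by rw [hb hb0])
  have h2 := Real.sqrt_le_sqrt (h c hc p.1 p.2 hp)
  rw [Real.sqrt_mul (by positivity), Real.sqrt_mul hC.le, Real.sqrt_sq (norm_nonneg _)] at h2
  rw [one_div, inv_mul_le_iff₀ (by positivity)]
  exact h2

theorem eventually_ne_zero_neg_one :
    ∀ᶠ p : ℤ × ℤ in cofinite, p ≠ (0, 0) ∧ p ≠ (0, -1) := by
  have : {p : ℤ × ℤ | ¬(p ≠ (0, 0) ∧ p ≠ (0, -1))} ⊆ {(0, 0), (0, -1)} := by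
    intro p hp
    simp only [Set.mem_ofPred_eq, not_and_or, not_not] at hp
    simpa using hp
  exact (Set.toFinite _).subset this

theorem summable_shiftedEis {k : ℕ} (hk : 2 ≤ k) {θ w : ℝ} (hθ₀ : 0 < θ) (hθ₁ : θ < 1)
    (hw : 0 < w) : Summable fun p : ℤ × ℤ => shiftedEis k θ w p.1 p.2 := by
  obtain ⟨C, hC, h⟩ := exists_latticeWeight_le_norm hw
  refine summable_of_isBigO (summable_one_div_latticeWeight_pow_three) ?_
  refine Asymptotics.IsBigO.of_bound (1 / C ^ (k + 1)) ?_
  filter_upwards [eventually_ne_zero_neg_one] with p hp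
  have h1 := h θ ⟨hθ₀.le, hθ₁.le⟩ p hp.1 hp.2
  have h2 := one_le_latticeWeight p
  have h3 : 0 < latticeWeight p := by linarith
  rw [shiftedEis, norm_div, norm_one, norm_pow, Real.norm_of_nonneg (by positivity)]
  calc 1 / ‖(p.1 : ℂ) * (Complex.I * w) + p.2 + θ‖ ^ (k + 1)
      ≤ 1 / (C * latticeWeight p) ^ (k + 1) := by gcongr
    _ = 1 / C ^ (k + 1) * (1 / latticeWeight p ^ (k + 1)) := by
        rw [mul_pow]; simp only [one_div, mul_inv]
    _ ≤ _ := by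
        gcongr 1 / C ^ (k + 1) * (1 / ?_)
        exact pow_le_pow_right₀ h2 (by omega)

/-- A telescoping series that compensates for the conditional convergence in weight two. -/
noncomputable def telescopingEis (w : ℝ) (m n : ℤ) : ℂ :=
  1 / ((m : ℂ) * (Complex.I * w) + n) - 1 / ((m : ℂ) * (Complex.I * w) + n + 1)

/-- Both terms behave like z^(-2) with the same leading coefficient, so the difference is
O(|z|^(-3)), which is summable over the lattice. -/
theorem summable_shiftedEis_sub_telescopingEis {θ w : ℝ} (hθ₀ : 0 < θ) (hθ₁ : θ < 1)
    (hw : 0 < w) :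
    Summable fun p : ℤ × ℤ => shiftedEis 1 θ w p.1 p.2 - telescopingEis w p.1 p.2 := by
  obtain ⟨C, hC, h⟩ := exists_latticeWeight_le_norm hw
  refine summable_of_isBigO (summable_one_div_latticeWeight_pow_three) ?_
  refine Asymptotics.IsBigO.of_bound (1 / C ^ 3 + 1 / C ^ 4) ?_
  filter_upwards [eventually_ne_zero_neg_one] with p hp
  have hθ := h θ ⟨hθ₀.le, hθ₁.le⟩ p hp.1 hp.2
  have h0 := h 0 (by simp) p hp.1 hp.2
  have h1 := h 1 (by simp) p hp.1 hp.2
  have h2 := one_le_latticeWeight p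
  have h3 : 0 < latticeWeight p := by linarith
  have h4 : 0 < C * latticeWeight p := by positivity
  rw [shiftedEis, telescopingEis, Real.norm_of_nonneg (by positivity)]
  rw [Complex.ofReal_zero, add_zero] at h0
  rw [Complex.ofReal_one] at h1
  set z : ℂ := (p.1 : ℂ) * (Complex.I * w) + p.2
  have n0 : z ≠ 0 := norm_pos_iff.1 (h4.trans_le h0)
  have n1 : z + 1 ≠ 0 := norm_pos_iff.1 (h4.trans_le h1)
  have nθ : z + θ ≠ 0 := norm_pos_iff.1 (h4.trans_le hθ)
  have e : 1 / (z + θ) ^ (1 + 1) - (1 / z - 1 / (z + 1)) =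
      ((1 - 2 * θ : ℝ) : ℂ) / (z * (z + 1) * (z + θ)) -
      ((θ * (1 - θ) : ℝ) : ℂ) / (z * (z + 1) * (z + θ) * (z + θ)) := by
    push_cast
    field_simp
    ring
  rw [e]
  refine (norm_sub_le _ _).trans ?_
  rw [norm_div, norm_div, Complex.norm_real, Complex.norm_real]
  simp only [norm_mul]
  have b1 : ‖1 - 2 * θ‖ ≤ 1 := by rw [Real.norm_eq_abs, abs_le]; constructor <;> linarith
  have b2 : ‖θ‖ * ‖1 - θ‖ ≤ 1 := by
    rw [Real.norm_of_nonneg hθ₀.le, Real.norm_of_nonneg (by linarith)]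
    nlinarith
  calc ‖1 - 2 * θ‖ / (‖z‖ * ‖z + 1‖ * ‖z + θ‖) +
        ‖θ‖ * ‖1 - θ‖ / (‖z‖ * ‖z + 1‖ * ‖z + θ‖ * ‖z + θ‖)
      ≤ 1 / (C * latticeWeight p * (C * latticeWeight p) * (C * latticeWeight p)) +
        1 / (C * latticeWeight p * (C * latticeWeight p) * (C * latticeWeight p) *
          (C * latticeWeight p)) := by gcongr
    _ = 1 / C ^ 3 * (1 / latticeWeight p ^ 3) + 1 / C ^ 4 * (1 / latticeWeight p ^ 4) := by
        field_simp
    _ ≤ 1 / C ^ 3 * (1 / latticeWeight p ^ 3) + 1 / C ^ 4 * (1 / latticeWeight p ^ 3) := by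
        gcongr 1 / C ^ 3 * (1 / latticeWeight p ^ 3) + 1 / C ^ 4 * (1 / ?_)
        exact pow_le_pow_right₀ h2 (by omega)
    _ = _ := by ring

theorem summable_pow_mul_exp_mul_add (k : ℕ) {b v : ℝ} (hb : 0 < b) (hv : 0 < v) :
    Summable fun p : ℕ+ × ℕ =>
      ((p.1 : ℕ) : ℝ) ^ k * Real.exp (-(v * (p.2 + b)) * (p.1 : ℕ)) := by
  have h1 := summable_pnat_pow_mul_exp k (mul_pos hv hb)
  have h2 : Summable fun n : ℕ => Real.exp ((n : ℝ) * (-v)) :=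
    Real.summable_exp_nat_mul_iff.2 (by linarith)
  refine Summable.of_nonneg_of_le (fun p => by positivity) (fun p => ?_)
    (h1.mul_of_nonneg h2 (fun n => by positivity) (fun n => by positivity))
  rw [mul_assoc, ← Real.exp_add]
  gcongr
  have hd : (1 : ℝ) ≤ (p.1 : ℕ) := by exact_mod_cast p.1.pos
  have hn : (0 : ℝ) ≤ p.2 := p.2.cast_nonneg
  have : v * p.2 * 1 ≤ v * p.2 * (p.1 : ℕ) := by gcongr
  linarith

theorem summable_pow_mul_ofReal_exp (k : ℕ) {b w : ℝ} (hb : 0 < b) (hw : 0 < w) :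
    Summable fun p : ℕ+ × ℕ => ((p.1 : ℕ) : ℂ) ^ k *
      ((Real.exp (-(2 * Real.pi * ((p.2 + b) / w)) * (p.1 : ℕ)) : ℝ) : ℂ) := by
  have h := summable_pow_mul_exp_mul_add k hb (v := 2 * Real.pi / w) (by positivity)
  have h' := Complex.hasSum_ofReal.2 h.hasSum |>.summable
  refine h'.congr fun p => ?_
  push_cast
  congr 3
  ring

theorem summable_tsum_shiftedEis_left {k : ℕ} (hk : Odd k) {θ w : ℝ} (hθ₀ : 0 < θ) (hθ₁ : θ < 1)
    (hw : 0 < w) : Summable fun n : ℤ => ∑' m : ℤ, shiftedEis k θ w m n := by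
  refine Summable.of_nat_of_neg_add_one ?_ ?_
  · simp_rw [tsum_shiftedEis_left hk hθ₀ hw]
    exact (summable_pow_mul_ofReal_exp k hθ₀ hw).prod_symm.prod.mul_left _
  · simp_rw [tsum_shiftedEis_left_neg hk hθ₁ hw, add_sub_assoc]
    exact (summable_pow_mul_ofReal_exp k (sub_pos.2 hθ₁) hw).prod_symm.prod.mul_left _

theorem tsum_shiftedEis_comm_of_two_le {k : ℕ} (hk : 2 ≤ k) {θ w : ℝ} (hθ₀ : 0 < θ) (hθ₁ : θ < 1)
    (hw : 0 < w) :
    (Summable fun m : ℤ => ∑' n : ℤ, shiftedEis k θ w m n) ∧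
    ∑' m : ℤ, ∑' n : ℤ, shiftedEis k θ w m n = ∑' n : ℤ, ∑' m : ℤ, shiftedEis k θ w m n :=
  ⟨(summable_shiftedEis hk hθ₀ hθ₁ hw).prod,
    ((summable_shiftedEis hk hθ₀ hθ₁ hw).tsum_comm (f := shiftedEis k θ w)).symm⟩

theorem HasSum.tendsto_sum_Ico_neg {f : ℤ → ℂ} {s : ℂ} (h : HasSum f s) :
    Tendsto (fun N : ℕ+ => ∑ n ∈ Finset.Ico (-((N : ℕ) : ℤ)) ((N : ℕ) : ℤ), f n) atTop (𝓝 s) := by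
  have h1 : HasSum f s (SummationFilter.symmetricIco ℤ) :=
    Tendsto.mono_left h SummationFilter.LeAtTop.le_atTop
  rw [SummationFilter.hasSum_symmetricIco_int_iff] at h1
  exact h1.comp (PNat.tendsto_comp_val_iff.2 tendsto_id)

/-- Sums of the corrected series may be exchanged. The telescoping part contributes 0 by rows but
-2π/w by columns, and this accounts for the defect. -/
theorem tsum_shiftedEis_comm_one {θ w : ℝ} (hθ₀ : 0 < θ) (hθ₁ : θ < 1) (hw : 0 < w) :
    (Summable fun m : ℤ => ∑' n : ℤ, shiftedEis 1 θ w m n) ∧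
    ∑' m : ℤ, ∑' n : ℤ, shiftedEis 1 θ w m n =
      ∑' n : ℤ, ∑' m : ℤ, shiftedEis 1 θ w m n + 2 * Real.pi / w := by
  let z : UpperHalfPlane := ⟨Complex.I * w, by simpa using hw⟩
  have hz : (z : ℂ) = Complex.I * w := rfl
  have hE := summable_shiftedEis_sub_telescopingEis hθ₀ hθ₁ hw
  have hGr : ∀ m : ℤ, Summable fun n : ℤ => telescopingEis w m n :=
    EisensteinSeries.summable_right_one_div_linear_sub_one_div_linear_succ z
  have hGl : ∀ n : ℤ, Summable fun m : ℤ => telescopingEis w m n := by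
    intro n
    refine (EisensteinSeries.summable_left_one_div_linear_sub_one_div_linear z n (n + 1)).congr
      fun m => ?_
    rw [telescopingEis, hz]
    push_cast
    rw [add_assoc]
  have hG0 : ∀ m : ℤ, ∑' n : ℤ, telescopingEis w m n = 0 := by
    intro m
    have h := EisensteinSeries.tsum_symmetricIco_linear_sub_linear_add_one_eq_zero z m
    exact (tsum_eq_of_summable_unconditional (hGr m)).symm.trans h
  have hrow : ∀ m : ℤ, ∑' n : ℤ, (shiftedEis 1 θ w m n - telescopingEis w m n) =
      ∑' n : ℤ, shiftedEis 1 θ w m n := by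
    intro m
    have h1 := hE.prod_factor m
    have h2 : Summable fun n : ℤ => shiftedEis 1 θ w m n :=
      (h1.add (hGr m)).congr fun n => by ring
    rw [h2.tsum_sub (hGr m), hG0, sub_zero]
  have hcol : ∀ n : ℤ, ∑' m : ℤ, shiftedEis 1 θ w m n =
      ∑' m : ℤ, (shiftedEis 1 θ w m n - telescopingEis w m n) + ∑' m : ℤ, telescopingEis w m n := by
    intro n
    have h1 : Summable fun m : ℤ => shiftedEis 1 θ w m n - telescopingEis w m n :=
      hE.prod_symm.prod_factor n
    rw [← Summable.tsum_add h1 (hGl n)]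
    exact tsum_congr fun m => by ring
  have hS := hE.prod
  simp only [hrow] at hS
  refine ⟨hS, ?_⟩
  have hswap := hE.tsum_comm (f := fun m n => shiftedEis 1 θ w m n - telescopingEis w m n)
  simp only [hrow] at hswap
  -- The telescoping column sums are known only as a limit over windows [-N, N), so all three series
  -- are compared along these windows.
  have l1 := (summable_tsum_shiftedEis_left odd_one hθ₀ hθ₁ hw).hasSum.tendsto_sum_Ico_neg
  have l2 := hE.prod_symm.prod.hasSum.tendsto_sum_Ico_neg
  have l3 := EisensteinSeries.tendsto_tsum_one_div_linear_sub_succ_eq z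
  have l4 := l2.add l3
  simp only [← Finset.sum_add_distrib] at l4
  have := tendsto_nhds_unique l1 (l4.congr fun N => Finset.sum_congr rfl fun n _ => (hcol n).symm)
  rw [this, ← hswap, hz]
  simp only [Prod.swap]
  have hw' : (w : ℂ) ≠ 0 := by exact_mod_cast hw.ne'
  have hI := Complex.I_ne_zero
  field_simp
  ring

theorem tsum_shiftedEis_comm {k : ℕ} (hk : Odd k) {θ w : ℝ} (hθ₀ : 0 < θ) (hθ₁ : θ < 1)
    (hw : 0 < w) :
    (Summable fun m : ℤ => ∑' n : ℤ, shiftedEis k θ w m n) ∧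
    ∑' m : ℤ, ∑' n : ℤ, shiftedEis k θ w m n =
      ∑' n : ℤ, ∑' m : ℤ, shiftedEis k θ w m n +
        (if k = 1 then 1 else 0) * (2 * Real.pi / w) := by
  by_cases h1 : k = 1
  · subst h1
    simpa using tsum_shiftedEis_comm_one hθ₀ hθ₁ hw
  · have hk2 : 2 ≤ k := by have := hk.pos; omega
    simpa [h1] using tsum_shiftedEis_comm_of_two_le hk2 hθ₀ hθ₁ hw

/-! ### Hurwitz zeta values and the transformation of the Lambert series -/

theorem hasSum_one_div_nat_add_pow {k : ℕ} (hk : 1 ≤ k) {θ : ℝ} (hθ₀ : 0 < θ) (hθ₁ : θ < 1) :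
    HasSum (fun n : ℕ => 1 / ((n : ℂ) + θ) ^ (k + 1))
      (HurwitzZeta.hurwitzZeta (θ : UnitAddCircle) (k + 1)) := by
  have hre : 1 < ((k : ℂ) + 1).re := by
    simp only [Complex.add_re, Complex.natCast_re, Complex.one_re]
    have : (1 : ℝ) ≤ k := by exact_mod_cast hk
    linarith
  refine (HurwitzZeta.hasSum_hurwitzZeta_of_one_lt_re ⟨hθ₀.le, hθ₁.le⟩ hre).congr_fun fun n => ?_
  rw [← Complex.cpow_natCast]
  push_cast
  rfl

theorem tsum_one_div_int_add_pow_eq_hurwitzZeta {k : ℕ} (hk : Odd k) {θ : ℝ} (hθ₀ : 0 < θ)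
    (hθ₁ : θ < 1) :
    ∑' n : ℤ, 1 / ((n : ℂ) + θ) ^ (k + 1) =
      HurwitzZeta.hurwitzZeta (θ : UnitAddCircle) (k + 1) +
        HurwitzZeta.hurwitzZeta ((1 - θ : ℝ) : UnitAddCircle) (k + 1) := by
  refine (HasSum.of_nat_of_neg_add_one (f := fun n : ℤ => 1 / ((n : ℂ) + θ) ^ (k + 1))
    (by simpa using hasSum_one_div_nat_add_pow hk.pos hθ₀ hθ₁) ?_).tsum_eq
  refine (hasSum_one_div_nat_add_pow (θ := 1 - θ) hk.pos (by linarith) (by linarith)).congr_fun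
    fun n => ?_
  rw [← hk.add_one.neg_pow]
  congr 2
  push_cast
  ring

/-- The sum `∑_{m, d ≥ 1} d ^ k cos (2π d θ) exp (-2π w m d)`. -/
noncomputable def lambertSum (k : ℕ) (θ w : ℝ) : ℂ :=
  ∑' p : ℕ+ × ℕ+, ((p.2 : ℕ) : ℂ) ^ k * ((Real.cos (2 * Real.pi * (p.2 : ℕ) * θ) : ℝ) : ℂ) *
    ((Real.exp (-(2 * Real.pi * (w * (p.1 : ℕ))) * (p.2 : ℕ)) : ℝ) : ℂ)

/-- The sum of `d ^ k (exp (-2π d (n + θ) / w) + exp (-2π d (n + 1 - θ) / w))` over `d ≥ 1`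
and `n ≥ 0`. -/
noncomputable def dualSum (k : ℕ) (θ w : ℝ) : ℂ :=
  ∑' p : ℕ+ × ℕ, ((p.1 : ℕ) : ℂ) ^ k *
    (((Real.exp (-(2 * Real.pi * ((p.2 + θ) / w)) * (p.1 : ℕ)) : ℝ) : ℂ) +
      ((Real.exp (-(2 * Real.pi * ((p.2 + 1 - θ) / w)) * (p.1 : ℕ)) : ℝ) : ℂ))

theorem summable_lambertSum (k : ℕ) (θ : ℝ) {w : ℝ} (hw : 0 < w) :
    Summable fun p : ℕ+ × ℕ+ =>
      ((p.2 : ℕ) : ℂ) ^ k * ((Real.cos (2 * Real.pi * (p.2 : ℕ) * θ) : ℝ) : ℂ) *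
    ((Real.exp (-(2 * Real.pi * (w * (p.1 : ℕ))) * (p.2 : ℕ)) : ℝ) : ℂ) := by
  -- Half of 2πw suffices: 2md ≥ m + d separates the exponential into a product.
  have hv : 0 < Real.pi * w := by positivity
  have h1 := summable_pnat_pow_mul_exp k hv
  have h2 := summable_pnat_pow_mul_exp 0 hv
  refine Summable.of_norm_bounded
    (h2.mul_of_nonneg h1 (fun n => by positivity) (fun n => by positivity)) fun p => ?_
  rw [norm_mul, norm_mul, norm_pow, Complex.norm_natCast, Complex.norm_real, Complex.norm_real,
    Real.norm_of_nonneg (Real.exp_pos _).le, pow_zero, one_mul,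
    mul_left_comm (Real.exp _), ← Real.exp_add]
  have hd : (1 : ℝ) ≤ (p.1 : ℕ) := by exact_mod_cast p.1.pos
  have hd' : (1 : ℝ) ≤ (p.2 : ℕ) := by exact_mod_cast p.2.pos
  gcongr
  · exact mul_le_of_le_one_right (by positivity) (Real.abs_cos_le_one _)
  · nlinarith [mul_nonneg hv.le (mul_nonneg (sub_nonneg.2 hd) (sub_nonneg.2 hd')),
      mul_nonneg hv.le (mul_nonneg (zero_le_one.trans hd) (sub_nonneg.2 hd')),
      mul_nonneg hv.le (mul_nonneg (zero_le_one.trans hd') (sub_nonneg.2 hd))]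

theorem dualSum_eq_add {k : ℕ} {θ w : ℝ} (hθ₀ : 0 < θ) (hθ₁ : θ < 1) (hw : 0 < w) :
    dualSum k θ w = ∑' (n : ℕ) (d : ℕ+), ((d : ℕ) : ℂ) ^ k *
          ((Real.exp (-(2 * Real.pi * ((n + θ) / w)) * (d : ℕ)) : ℝ) : ℂ) +
        ∑' (n : ℕ) (d : ℕ+), ((d : ℕ) : ℂ) ^ k *
          ((Real.exp (-(2 * Real.pi * ((n + 1 - θ) / w)) * (d : ℕ)) : ℝ) : ℂ) := by
  have h1 := summable_pow_mul_ofReal_exp k hθ₀ hw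
  have h2 := summable_pow_mul_ofReal_exp k (sub_pos.2 hθ₁) hw
  simp_rw [← add_sub_assoc] at h2
  rw [dualSum]
  simp_rw [mul_add]
  rw [h1.tsum_add h2]
  congr 1
  · exact ((Equiv.prodComm ℕ ℕ+).tsum_eq _).symm.trans h1.prod_symm.tsum_prod
  · exact ((Equiv.prodComm ℕ ℕ+).tsum_eq _).symm.trans h2.prod_symm.tsum_prod

theorem tsum_tsum_shiftedEis_left {k : ℕ} (hk : Odd k) {θ w : ℝ} (hθ₀ : 0 < θ) (hθ₁ : θ < 1)
    (hw : 0 < w) :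
    ∑' n : ℤ, ∑' m : ℤ, shiftedEis k θ w m n =
      (-1) ^ ((k + 1) / 2) / (w : ℂ) ^ (k + 1) *
      ((-2 * Real.pi * Complex.I) ^ (k + 1) / (k.factorial : ℂ)) * dualSum k θ w := by
  have h := summable_tsum_shiftedEis_left hk hθ₀ hθ₁ hw
  have hp : Summable fun n : ℕ => ∑' m : ℤ, shiftedEis k θ w m n :=
    h.comp_injective (i := fun n : ℕ => (n : ℤ)) Nat.cast_injective
  have hn : Summable fun n : ℕ => ∑' m : ℤ, shiftedEis k θ w m (-((n : ℤ) + 1)) :=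
    h.comp_injective (i := fun n : ℕ => -((n : ℤ) + 1)) fun a b hab => by simpa using hab
  refine (tsum_of_nat_of_neg_add_one
    (f := fun n : ℤ => ∑' m : ℤ, shiftedEis k θ w m n) hp hn).trans ?_
  rw [dualSum_eq_add hθ₀ hθ₁ hw, mul_add]
  refine congrArg₂ (· + ·) ?_ ?_
  · exact (tsum_congr fun n => tsum_shiftedEis_left hk hθ₀ hw n).trans tsum_mul_left
  · exact (tsum_congr fun n => tsum_shiftedEis_left_neg hk hθ₁ hw n).trans tsum_mul_left

theorem tsum_tsum_shiftedEis {k : ℕ} (hk : Odd k) {θ w : ℝ} (hθ₀ : 0 < θ) (hθ₁ : θ < 1)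
    (hw : 0 < w) :
    ∑' m : ℤ, ∑' n : ℤ, shiftedEis k θ w m n =
      HurwitzZeta.hurwitzZeta (θ : UnitAddCircle) (k + 1) +
        HurwitzZeta.hurwitzZeta ((1 - θ : ℝ) : UnitAddCircle) (k + 1) +
      2 * ((-2 * Real.pi * Complex.I) ^ (k + 1) / (k.factorial : ℂ)) * lambertSum k θ w := by
  have h := (tsum_shiftedEis_comm hk hθ₀ hθ₁ hw).1
  have hp : Summable fun m : ℕ+ => ∑' n : ℤ, shiftedEis k θ w ((m : ℕ) : ℤ) n :=
    h.comp_injective (i := fun m : ℕ+ => ((m : ℕ) : ℤ)) fun a b hab => by simpa using hab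
  have hn : Summable fun m : ℕ+ => ∑' n : ℤ, shiftedEis k θ w (-((m : ℕ) : ℤ)) n :=
    h.comp_injective (i := fun m : ℕ+ => -((m : ℕ) : ℤ)) fun a b hab => by simpa using hab
  rw [tsum_int_eq_zero_add_tsum_pnat h, add_assoc, ← hp.tsum_add hn, lambertSum,
    (summable_lambertSum k θ hw).tsum_prod, ← tsum_mul_left,
    ← tsum_one_div_int_add_pow_eq_hurwitzZeta hk hθ₀ hθ₁]
  simp_rw [tsum_shiftedEis_add_tsum_neg hk θ hw]
  congr 1
  refine tsum_congr fun n => ?_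
  rw [shiftedEis, Int.cast_zero, zero_mul, zero_add]

/-- The transformation formula for the twisted Lambert series. -/
theorem lambertSum_eq {k : ℕ} (hk : Odd k) {θ w : ℝ} (hθ₀ : 0 < θ) (hθ₁ : θ < 1) (hw : 0 < w) :
    lambertSum k θ w =
      (-1) ^ ((k + 1) / 2) / (2 * (w : ℂ) ^ (k + 1)) * dualSum k θ w -
      (-1) ^ ((k + 1) / 2) * (k.factorial : ℂ) / (2 * (2 * (Real.pi : ℂ)) ^ (k + 1)) *
        (HurwitzZeta.hurwitzZeta (θ : UnitAddCircle) (k + 1) +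
          HurwitzZeta.hurwitzZeta ((1 - θ : ℝ) : UnitAddCircle) (k + 1)) -
      (if k = 1 then 1 else 0) * (1 / (4 * Real.pi * w)) := by
  have h1 := (tsum_shiftedEis_comm hk hθ₀ hθ₁ hw).2
  rw [tsum_tsum_shiftedEis hk hθ₀ hθ₁ hw, tsum_tsum_shiftedEis_left hk hθ₀ hθ₁ hw,
    neg_two_pi_I_pow_succ hk] at h1
  have hpi : (Real.pi : ℂ) ≠ 0 := by exact_mod_cast Real.pi_ne_zero
  have hw' : (w : ℂ) ≠ 0 := by exact_mod_cast hw.ne'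
  have hf : (k.factorial : ℂ) ≠ 0 := by exact_mod_cast k.factorial_ne_zero
  have e1 : ((-1 : ℂ) ^ ((k + 1) / 2)) * (-1) ^ ((k + 1) / 2) = 1 := by rw [← mul_pow]; simp
  have hε : ((-1 : ℂ) ^ ((k + 1) / 2)) ≠ 0 := by simp
  -- The defect 2π/w divided by the coefficient of the Lambert series; the minus sign is
  -- (-1)^((k+1)/2) at k = 1.
  have hδ : (if k = 1 then (1 : ℂ) else 0) * (1 / (4 * Real.pi * w)) =
      -(if k = 1 then (1 : ℂ) else 0) * ((-1) ^ ((k + 1) / 2) * (k.factorial : ℂ) /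
        (2 * (2 * (Real.pi : ℂ)) ^ (k + 1))) * (2 * Real.pi / w) := by
    split_ifs with hk1
    · subst hk1
      norm_num
      field_simp
      norm_num
    · simp
  rw [hδ]
  set ε : ℂ := (-1) ^ ((k + 1) / 2)
  set H := HurwitzZeta.hurwitzZeta (θ : UnitAddCircle) (k + 1) +
    HurwitzZeta.hurwitzZeta ((1 - θ : ℝ) : UnitAddCircle) (k + 1)
  set P : ℂ := (2 * (Real.pi : ℂ)) ^ (k + 1)
  have hP : P ≠ 0 := pow_ne_zero _ (mul_ne_zero two_ne_zero hpi)
  set δ : ℂ := (if k = 1 then (1 : ℂ) else 0)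
  have h2 : lambertSum k θ w = ε * (k.factorial : ℂ) / (2 * P) *
      (2 * (ε * P / (k.factorial : ℂ)) * lambertSum k θ w) := by
    field_simp
    linear_combination -(lambertSum k θ w) * e1
  have h3 : 2 * (ε * P / (k.factorial : ℂ)) * lambertSum k θ w =
      ε / (w : ℂ) ^ (k + 1) * (ε * P / (k.factorial : ℂ)) * dualSum k θ w +
        δ * (2 * Real.pi / w) - H := by linear_combination h1
  rw [h2, h3]
  have e2 : ε * (k.factorial : ℂ) / (2 * P) * (ε / (w : ℂ) ^ (k + 1) * (ε * P / (k.factorial : ℂ)) *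
      dualSum k θ w) = ε / (2 * (w : ℂ) ^ (k + 1)) * dualSum k θ w := by
    field_simp
    linear_combination (dualSum k θ w) * e1
  linear_combination e2

/-! ### Integrating the transformation formula term by term -/

-- Joining the two families over the disjoint union of their index types reduces this to one
-- exchange of sum and integral.
open MeasureTheory in
theorem tsum_integral_sub_tsum_integral {α ι κ : Type*} [MeasurableSpace α] {μ : Measure α}
    [Countable ι] [Countable κ] {F : ι → α → ℂ} {G : κ → α → ℂ} {H : α → ℂ}
    (hF : ∀ i, Integrable (F i) μ) (hG : ∀ j, Integrable (G j) μ)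
    (hF' : Summable fun i => ∫ t, ‖F i t‖ ∂μ) (hG' : Summable fun j => ∫ t, ‖G j t‖ ∂μ)
    (h : ∀ᵐ t ∂μ, (Summable fun i => F i t) ∧ (Summable fun j => G j t) ∧
      ∑' i, F i t - ∑' j, G j t = H t) :
    ∑' i, ∫ t, F i t ∂μ - ∑' j, ∫ t, G j t ∂μ = ∫ t, H t ∂μ := by
  let E : ι ⊕ κ → α → ℂ := Sum.elim F fun j t => -G j t
  have hE : ∀ i, Integrable (E i) μ := by
    rintro (i | j)
    · exact hF i
    · exact (hG j).neg
  have hE' : Summable fun i => ∫ t, ‖E i t‖ ∂μ := by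
    refine (HasSum.sum (f := fun i => ∫ t, ‖E i t‖ ∂μ) hF'.hasSum (Summable.hasSum ?_)).summable
    simpa [E, Function.comp_def] using hG'
  have h1 := hasSum_integral_of_summable_integral_norm hE hE'
  have h2 : ∫ t, ∑' i, E i t ∂μ = ∫ t, H t ∂μ := by
    refine integral_congr_ae (h.mono fun t ht => ?_)
    obtain ⟨hs1, hs2, he⟩ := ht
    have := (HasSum.sum (f := fun i => E i t) hs1.hasSum hs2.neg.hasSum).tsum_eq
    simp only [this, ← he, tsum_neg, sub_eq_add_neg]
  rw [← h2, ← h1.tsum_eq]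
  have s1 : Summable fun i => ∫ t, F i t ∂μ :=
    hF'.of_norm_bounded fun i => norm_integral_le_integral_norm _
  have s2 : Summable fun j => ∫ t, -G j t ∂μ := by
    simp only [integral_neg]
    exact (hG'.of_norm_bounded fun i => norm_integral_le_integral_norm _).neg
  rw [(HasSum.sum (f := fun i => ∫ t, E i t ∂μ) s1.hasSum s2.hasSum).tsum_eq]
  simp only [integral_neg, tsum_neg, sub_eq_add_neg]

/-- The integrand `exp (-t) t ^ (s - 1) exp (-c t)` of a Gamma integral. -/
noncomputable def gammaKernel (s : ℂ) (c t : ℝ) : ℂ :=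
  ((Real.exp (-t) : ℝ) : ℂ) * (t : ℂ) ^ (s - 1) * ((Real.exp (-(c * t)) : ℝ) : ℂ)

theorem norm_gammaKernel (s : ℂ) (c : ℝ) {t : ℝ} (ht : 0 < t) :
    ‖gammaKernel s c t‖ = t ^ (s.re - 1) * Real.exp (-((c + 1) * t)) := by
  rw [gammaKernel, norm_mul, norm_ofReal_mul_cpow (Real.exp_pos _).le ht, Complex.norm_real,
    Real.norm_of_nonneg (Real.exp_pos _).le, mul_right_comm, ← Real.exp_add, Complex.sub_re,
    Complex.one_re, mul_comm]
  congr 2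
  ring

open MeasureTheory in
theorem integrableOn_gammaKernel {s : ℂ} (hs : 0 < s.re) {c : ℝ} (hc : 0 ≤ c) :
    IntegrableOn (gammaKernel s c) (Set.Ioi 0) := by
  refine Integrable.mono' (Real.GammaIntegral_convergent hs) ?_ ?_
  · refine ContinuousOn.aestronglyMeasurable ?_ measurableSet_Ioi
    unfold gammaKernel
    exact ((Continuous.continuousOn (by fun_prop)).mul (continuousOn_ofReal_cpow_Ioi _)).mul
      (Continuous.continuousOn (by fun_prop))
  · refine (ae_restrict_iff' measurableSet_Ioi).2 (.of_forall fun t (ht : 0 < t) => ?_)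
    rw [norm_gammaKernel s c ht, mul_comm]
    gcongr
    nlinarith

theorem integral_gammaKernel {s : ℂ} (hs : 0 < s.re) {c : ℝ} (hc : 0 ≤ c) :
    ∫ t in Set.Ioi (0 : ℝ), gammaKernel s c t =
      Complex.Gamma s * (1 / ((c + 1 : ℝ) : ℂ) ^ s) := by
  have hc1 : 0 < c + 1 := by linarith
  have h := Complex.integral_cpow_mul_exp_neg_mul_Ioi hs hc1
  have e : (1 / ((c + 1 : ℝ) : ℂ)) ^ s = 1 / ((c + 1 : ℝ) : ℂ) ^ s := by
    rw [one_div, one_div, ← Complex.ofReal_inv, ofReal_cpow_eq_exp (by positivity),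
      ofReal_cpow_eq_exp hc1, ← Complex.exp_neg, Real.log_inv]
    push_cast
    ring_nf
  rw [mul_comm, ← e, ← h]
  refine MeasureTheory.integral_congr_ae (.of_forall fun t => ?_)
  simp only [gammaKernel]
  rw [mul_right_comm, Complex.ofReal_exp, Complex.ofReal_exp, ← Complex.exp_add, mul_comm]
  congr 2
  push_cast
  ring

theorem integral_norm_gammaKernel {s : ℂ} (hs : 0 < s.re) {c : ℝ} (hc : 0 ≤ c) :
    ∫ t in Set.Ioi (0 : ℝ), ‖gammaKernel s c t‖ = Real.Gamma s.re * (1 / (c + 1) ^ s.re) := by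
  have hc1 : 0 < c + 1 := by linarith
  have h := Real.integral_rpow_mul_exp_neg_mul_Ioi hs hc1
  rw [Real.div_rpow zero_le_one hc1.le, Real.one_rpow, mul_comm] at h
  rw [← h]
  exact MeasureTheory.setIntegral_congr_fun measurableSet_Ioi fun t ht => norm_gammaKernel s c ht

open MeasureTheory in
theorem integral_exp_neg_sub_div_mul_rpow_le {y σ : ℝ} (hy : 0 < y) (hσ : 0 < σ) (p : ℕ) :
    ∫ t in Set.Ioi (0 : ℝ), Real.exp (-t - y / t) * t ^ (σ - 1) ≤
      p.factorial / y ^ p * Real.Gamma (σ + p) := by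
  rw [Real.Gamma_eq_integral (by positivity), ← integral_const_mul]
  refine setIntegral_mono_on (integrableOn_exp_neg_sub_div_mul_rpow hy _)
    ((Real.GammaIntegral_convergent (by positivity)).const_mul _) measurableSet_Ioi
    fun t (ht : 0 < t) => ?_
  have h1 := exp_neg_le_factorial_div_pow (div_pos hy ht) p
  have h2 : 0 < t ^ (σ - 1) := Real.rpow_pos_of_pos ht _
  have e : σ + p - 1 = (σ - 1) + (p : ℕ) := by ring
  rw [sub_eq_add_neg, Real.exp_add, e, Real.rpow_add_natCast ht.ne']
  calc Real.exp (-t) * Real.exp (-(y / t)) * t ^ (σ - 1)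
      ≤ Real.exp (-t) * (p.factorial / (y / t) ^ p) * t ^ (σ - 1) := by gcongr
    _ = _ := by rw [div_pow]; field_simp

theorem summable_pnat_one_div_rpow {s : ℝ} (hs : 1 < s) :
    Summable fun d : ℕ+ => 1 / ((d : ℕ) : ℝ) ^ s :=
  (Real.summable_one_div_nat_rpow.2 hs).comp_injective PNat.coe_injective

/-- Dropping the +1 leaves d^(-σ-1) (m+b)^(-σ-k-1), so convergence in d rests exactly on σ > 0. -/
theorem summable_pow_div_mul_add_one_rpow (k : ℕ) {b κ σ : ℝ} (hb : 0 < b) (hκ : 0 < κ)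
    (hσ : 0 < σ) : Summable fun p : ℕ+ × ℕ => ((p.1 : ℕ) : ℝ) ^ k *
      (1 / (κ * ((p.1 : ℕ) * (p.2 + b)) + 1) ^ (σ + k + 1)) := by
  have h1 := summable_pnat_one_div_rpow (s := σ + 1) (by linarith)
  have h2 := (Real.summable_one_div_nat_add_rpow b (σ + k + 1)).2
    (by have : (0 : ℝ) ≤ k := k.cast_nonneg
        linarith)
  have hs : 0 < σ + k + 1 := by positivity
  refine Summable.of_nonneg_of_le (fun p => by positivity) (fun p => ?_)
    ((h1.mul_of_nonneg h2 (fun n => by positivity) (fun n => by positivity)).mul_left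
      (1 / κ ^ (σ + k + 1)))
  have hd : (0 : ℝ) < (p.1 : ℕ) := by exact_mod_cast p.1.pos
  have hm : (0 : ℝ) < p.2 + b := by positivity
  rw [abs_of_pos hm]
  calc ((p.1 : ℕ) : ℝ) ^ k * (1 / (κ * ((p.1 : ℕ) * (p.2 + b)) + 1) ^ (σ + k + 1))
      ≤ ((p.1 : ℕ) : ℝ) ^ k * (1 / (κ * ((p.1 : ℕ) * (p.2 + b))) ^ (σ + k + 1)) := by
        gcongr
        linarith
    _ = _ := by
        rw [Real.mul_rpow hκ.le (by positivity), Real.mul_rpow hd.le hm.le]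
        have e : σ + k + 1 = (σ + 1) + (k : ℕ) := by ring
        nth_rewrite 2 [e]
        rw [Real.rpow_add_natCast hd.ne']
        field_simp

theorem norm_one_div_ofReal_cpow {c : ℝ} (hc : 0 < c) (s : ℂ) :
    ‖1 / (c : ℂ) ^ s‖ = 1 / c ^ s.re := by
  rw [norm_div, norm_one, Complex.norm_cpow_eq_rpow_re_of_pos hc]

theorem summable_pow_div_mul_add_one_cpow (k : ℕ) {b κ : ℝ} {ν : ℂ} (hb : 0 < b) (hκ : 0 < κ)
    (hν : 0 < ν.re) : Summable fun p : ℕ+ × ℕ => ((p.1 : ℕ) : ℂ) ^ k *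
      (1 / ((κ * ((p.1 : ℕ) * (p.2 + b)) + 1 : ℝ) : ℂ) ^ (ν + k + 1)) := by
  refine Summable.of_norm ((summable_pow_div_mul_add_one_rpow k hb hκ hν).congr fun p => ?_)
  rw [norm_mul, norm_pow, Complex.norm_natCast, norm_one_div_ofReal_cpow (by positivity)]
  simp

/-- The summand `d ^ k cos (2π d θ) exp (-t - m d X / t) t ^ (ν - 1)`. -/
noncomputable def besselTerm (k : ℕ) (θ : ℝ) (ν : ℂ) (X : ℝ) (p : ℕ+ × ℕ+) (t : ℝ) : ℂ :=
  (((p.2 : ℕ) : ℂ) ^ k * ((Real.cos (2 * Real.pi * (p.2 : ℕ) * θ) : ℝ) : ℂ)) *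
    (((Real.exp (-t - ((p.1 : ℕ) * (p.2 : ℕ) * X) / t) : ℝ) : ℂ) * (t : ℂ) ^ (ν - 1))

open MeasureTheory in
theorem integrableOn_besselTerm (k : ℕ) (θ : ℝ) (ν : ℂ) {X : ℝ} (hX : 0 < X) (p : ℕ+ × ℕ+) :
    IntegrableOn (besselTerm k θ ν X p) (Set.Ioi 0) := by
  have hd : (0 : ℝ) < (p.1 : ℕ) := by exact_mod_cast p.1.pos
  have hd' : (0 : ℝ) < (p.2 : ℕ) := by exact_mod_cast p.2.pos
  exact (integrableOn_exp_neg_sub_div_mul_cpow (by positivity) (ν - 1)).const_mul _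

theorem integral_besselTerm (k : ℕ) (θ : ℝ) (ν : ℂ) (X : ℝ) (p : ℕ+ × ℕ+) :
    ∫ t in Set.Ioi (0 : ℝ), besselTerm k θ ν X p t =
      (((p.2 : ℕ) : ℂ) ^ k * ((Real.cos (2 * Real.pi * (p.2 : ℕ) * θ) : ℝ) : ℂ)) *
        macdonaldIntegral ν ((p.1 : ℕ) * (p.2 : ℕ) * X) :=
  MeasureTheory.integral_const_mul _ _

open MeasureTheory in
theorem summable_integral_norm_besselTerm (k : ℕ) (θ : ℝ) {ν : ℂ} (hν : 0 < ν.re) {X : ℝ}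
    (hX : 0 < X) :
    Summable fun p => ∫ t in Set.Ioi (0 : ℝ), ‖besselTerm k θ ν X p t‖ := by
  have h1 := summable_pnat_one_div_rpow (s := (2 : ℕ)) (by norm_num)
  have h2 := summable_pnat_one_div_rpow (s := (k + 2 : ℕ)) (by push_cast; linarith [k.cast_nonneg (α := ℝ)])
  simp only [Real.rpow_natCast] at h1 h2
  refine Summable.of_nonneg_of_le (fun p => integral_nonneg fun t => norm_nonneg _) (fun p => ?_)
    ((h2.mul_of_nonneg h1 (fun n => by positivity) (fun n => by positivity)).mul_left
      ((k + 2).factorial / X ^ (k + 2) * Real.Gamma (ν.re + (k + 2 : ℕ))))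
  have hd : (0 : ℝ) < (p.1 : ℕ) := by exact_mod_cast p.1.pos
  have hd' : (0 : ℝ) < (p.2 : ℕ) := by exact_mod_cast p.2.pos
  have hG : 0 < Real.Gamma (ν.re + (k + 2 : ℕ)) := Real.Gamma_pos_of_pos (by positivity)
  -- The exponent k + 2 leaves d^k (md)^(-k-2) = d^(-2) m^(-k-2), summable in both variables.
  have h3 := integral_exp_neg_sub_div_mul_rpow_le (y := (p.1 : ℕ) * (p.2 : ℕ) * X)
    (by positivity) hν (k + 2)
  have h4 : ∫ t in Set.Ioi (0 : ℝ), ‖besselTerm k θ ν X p t‖ =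
      ((p.2 : ℕ) : ℝ) ^ k * |Real.cos (2 * Real.pi * (p.2 : ℕ) * θ)| *
      ∫ t in Set.Ioi (0 : ℝ), Real.exp (-t - ((p.1 : ℕ) * (p.2 : ℕ) * X) / t) * t ^ (ν.re - 1) := by
    rw [← integral_const_mul]
    refine setIntegral_congr_fun measurableSet_Ioi fun t (ht : 0 < t) => ?_
    simp only [besselTerm]
    rw [norm_mul, norm_ofReal_mul_cpow (Real.exp_pos _).le ht, norm_mul, norm_pow,
      Complex.norm_natCast, Complex.norm_real, Real.norm_eq_abs, Complex.sub_re, Complex.one_re]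
  rw [h4]
  calc _ ≤ ((p.2 : ℕ) : ℝ) ^ k * 1 * ((k + 2).factorial / ((p.1 : ℕ) * (p.2 : ℕ) * X) ^ (k + 2) *
        Real.Gamma (ν.re + (k + 2 : ℕ))) := by
        gcongr
        · exact setIntegral_nonneg measurableSet_Ioi fun t (ht : 0 < t) => by positivity
        · exact Real.abs_cos_le_one _
    _ = _ := by
        rw [mul_pow, mul_pow, pow_add ((p.2 : ℕ) : ℝ) k 2]
        field_simp

/-- The choice w = X/(2πt) makes 2πwmd equal to mdX/t. -/
theorem summable_besselTerm (k : ℕ) (θ : ℝ) (ν : ℂ) {X t : ℝ} (hX : 0 < X) (ht : 0 < t) :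
    (Summable fun p => besselTerm k θ ν X p t) ∧
    ∑' p, besselTerm k θ ν X p t = ((Real.exp (-t) : ℝ) : ℂ) * (t : ℂ) ^ (ν - 1) *
      lambertSum k θ (X / (2 * Real.pi * t)) := by
  have hpi := Real.pi_pos
  have hw : 0 < X / (2 * Real.pi * t) := by positivity
  have h := (summable_lambertSum k θ hw).hasSum.mul_left
    (((Real.exp (-t) : ℝ) : ℂ) * (t : ℂ) ^ (ν - 1))
  have h' : HasSum (fun p => besselTerm k θ ν X p t) (((Real.exp (-t) : ℝ) : ℂ) *
      (t : ℂ) ^ (ν - 1) * lambertSum k θ (X / (2 * Real.pi * t))) := by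
    refine h.congr_fun fun p => ?_
    have e : Real.exp (-t - ((p.1 : ℕ) * (p.2 : ℕ) * X) / t) = Real.exp (-t) *
        Real.exp (-(2 * Real.pi * (X / (2 * Real.pi * t) * (p.1 : ℕ))) * (p.2 : ℕ)) := by
      rw [← Real.exp_add]
      congr 1
      field_simp
      ring
    rw [besselTerm, e]
    push_cast
    ring
  exact ⟨h'.summable, h'.tsum_eq⟩

/-- The summand of the dual series, as a function of the integration variable. -/
noncomputable def dualTerm (k : ℕ) (θ : ℝ) (s : ℂ) (κ : ℝ) (p : ℕ+ × ℕ) (t : ℝ) : ℂ :=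
  ((p.1 : ℕ) : ℂ) ^ k * (gammaKernel s (κ * ((p.1 : ℕ) * (p.2 + θ))) t +
    gammaKernel s (κ * ((p.1 : ℕ) * (p.2 + 1 - θ))) t)

theorem dualTerm_arg_nonneg {θ κ : ℝ} (hθ₀ : 0 < θ) (hθ₁ : θ < 1) (hκ : 0 < κ) (p : ℕ+ × ℕ) :
    0 ≤ κ * ((p.1 : ℕ) * (p.2 + θ)) ∧ 0 ≤ κ * ((p.1 : ℕ) * (p.2 + 1 - θ)) := by
  have hm : (0 : ℝ) ≤ p.2 := p.2.cast_nonneg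
  have h1 : (0 : ℝ) ≤ p.2 + 1 - θ := by linarith
  constructor <;> positivity

open MeasureTheory in
theorem integrableOn_dualTerm (k : ℕ) {θ κ : ℝ} {s : ℂ} (hθ₀ : 0 < θ) (hθ₁ : θ < 1) (hκ : 0 < κ)
    (hs : 0 < s.re) (p : ℕ+ × ℕ) : IntegrableOn (dualTerm k θ s κ p) (Set.Ioi 0) := by
  have h := dualTerm_arg_nonneg hθ₀ hθ₁ hκ p
  exact ((integrableOn_gammaKernel hs h.1).add (integrableOn_gammaKernel hs h.2)).const_mul _

open MeasureTheory in
theorem integral_dualTerm (k : ℕ) {θ κ : ℝ} {s : ℂ} (hθ₀ : 0 < θ) (hθ₁ : θ < 1) (hκ : 0 < κ)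
    (hs : 0 < s.re) (p : ℕ+ × ℕ) :
    ∫ t in Set.Ioi (0 : ℝ), dualTerm k θ s κ p t = Complex.Gamma s * (((p.1 : ℕ) : ℂ) ^ k *
      (1 / ((κ * ((p.1 : ℕ) * (p.2 + θ)) + 1 : ℝ) : ℂ) ^ s +
        1 / ((κ * ((p.1 : ℕ) * (p.2 + 1 - θ)) + 1 : ℝ) : ℂ) ^ s)) := by
  have h := dualTerm_arg_nonneg hθ₀ hθ₁ hκ p
  unfold dualTerm
  rw [integral_const_mul, integral_add (integrableOn_gammaKernel hs h.1)
    (integrableOn_gammaKernel hs h.2), integral_gammaKernel hs h.1, integral_gammaKernel hs h.2]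
  ring

open MeasureTheory in
theorem summable_integral_norm_dualTerm (k : ℕ) {θ κ : ℝ} {ν : ℂ} (hθ₀ : 0 < θ) (hθ₁ : θ < 1)
    (hκ : 0 < κ) (hν : 0 < ν.re) :
    Summable fun p => ∫ t in Set.Ioi (0 : ℝ), ‖dualTerm k θ (ν + k + 1) κ p t‖ := by
  have hre : (ν + k + 1).re = ν.re + k + 1 := by simp
  have hs : 0 < (ν + k + 1).re := by rw [hre]; positivity
  have h1 := summable_pow_div_mul_add_one_rpow k hθ₀ hκ hν
  have h2 := summable_pow_div_mul_add_one_rpow k (sub_pos.2 hθ₁) hκ hν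
  refine Summable.of_nonneg_of_le (fun p => integral_nonneg fun t => norm_nonneg _) (fun p => ?_)
    ((h1.add h2).mul_left (Real.Gamma (ν.re + k + 1)))
  have h := dualTerm_arg_nonneg hθ₀ hθ₁ hκ p
  have i1 := integrableOn_gammaKernel hs h.1
  have i2 := integrableOn_gammaKernel hs h.2
  calc ∫ t in Set.Ioi (0 : ℝ), ‖dualTerm k θ (ν + k + 1) κ p t‖
      ≤ ∫ t in Set.Ioi (0 : ℝ), ((p.1 : ℕ) : ℝ) ^ k *
        (‖gammaKernel (ν + k + 1) (κ * ((p.1 : ℕ) * (p.2 + θ))) t‖ +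
          ‖gammaKernel (ν + k + 1) (κ * ((p.1 : ℕ) * (p.2 + 1 - θ))) t‖) := by
        refine integral_mono (integrableOn_dualTerm k hθ₀ hθ₁ hκ hs p).norm
          ((i1.norm.add i2.norm).const_mul _) fun t => ?_
        simp only [dualTerm]
        rw [norm_mul, norm_pow, Complex.norm_natCast]
        gcongr
        exact norm_add_le _ _
    _ = _ := by
        rw [integral_const_mul, integral_add i1.norm i2.norm, integral_norm_gammaKernel hs h.1,
          integral_norm_gammaKernel hs h.2, hre, add_sub_assoc]
        ring

/-- For the same w the dual exponent 2πdb/w equals (4π²/X) d b t, linear in t; hence the value of κ.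
-/
theorem summable_dualTerm (k : ℕ) {θ : ℝ} (s : ℂ) {X t : ℝ} (hθ₀ : 0 < θ) (hθ₁ : θ < 1)
    (hX : 0 < X) (ht : 0 < t) :
    (Summable fun p => dualTerm k θ s (4 * Real.pi ^ 2 / X) p t) ∧
    ∑' p, dualTerm k θ s (4 * Real.pi ^ 2 / X) p t =
      ((Real.exp (-t) : ℝ) : ℂ) * (t : ℂ) ^ (s - 1) * dualSum k θ (X / (2 * Real.pi * t)) := by
  have hpi := Real.pi_pos
  have hw : 0 < X / (2 * Real.pi * t) := by positivity
  have h1 := summable_pow_mul_ofReal_exp k hθ₀ hw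
  have h2 := summable_pow_mul_ofReal_exp k (sub_pos.2 hθ₁) hw
  simp_rw [← add_sub_assoc] at h2
  have h3 := h1.add h2
  simp_rw [← mul_add] at h3
  have h := h3.hasSum.mul_left (((Real.exp (-t) : ℝ) : ℂ) * (t : ℂ) ^ (s - 1))
  have h' : HasSum (fun p => dualTerm k θ s (4 * Real.pi ^ 2 / X) p t)
      (((Real.exp (-t) : ℝ) : ℂ) * (t : ℂ) ^ (s - 1) * dualSum k θ (X / (2 * Real.pi * t))) := by
    refine h.congr_fun fun p => ?_
    have e : ∀ b : ℝ, -(2 * Real.pi * (b / (X / (2 * Real.pi * t)))) * (p.1 : ℕ) =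
        -(4 * Real.pi ^ 2 / X * ((p.1 : ℕ) * b) * t) := by
      intro b
      field_simp
      ring
    rw [dualTerm, gammaKernel, gammaKernel, e, e]
    ring
  exact ⟨h'.summable, h'.tsum_eq⟩

open MeasureTheory in
/-- The identity of the theorem in the variable `X = a ^ 2 x / 4`, before passing from pairs
`(m, d)` to the sum over `n = m d`. -/
theorem tsum_macdonaldIntegral_sub {k : ℕ} (hk : Odd k) {ν : ℂ} (hν : 0 < ν.re) {θ X : ℝ}
    (hθ₀ : 0 < θ) (hθ₁ : θ < 1) (hX : 0 < X) :
    ∑' p : ℕ+ × ℕ+, ((p.2 : ℕ) : ℂ) ^ k *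
        ((Real.cos (2 * Real.pi * (p.2 : ℕ) * θ) : ℝ) : ℂ) *
        macdonaldIntegral ν ((p.1 : ℕ) * (p.2 : ℕ) * X) -
      (-1) ^ ((k + 1) / 2) / 2 * (2 * Real.pi / X) ^ (k + 1) * Complex.Gamma (ν + k + 1) *
        ∑' p : ℕ+ × ℕ, ((p.1 : ℕ) : ℂ) ^ k *
          (1 / ((4 * Real.pi ^ 2 / X * ((p.1 : ℕ) * (p.2 + θ)) + 1 : ℝ) : ℂ) ^ (ν + k + 1) +
            1 / ((4 * Real.pi ^ 2 / X * ((p.1 : ℕ) * (p.2 + 1 - θ)) + 1 : ℝ) : ℂ) ^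
              (ν + k + 1)) =
      -((-1) ^ ((k + 1) / 2) * (k.factorial : ℂ) / (2 * (2 * (Real.pi : ℂ)) ^ (k + 1)) *
        (HurwitzZeta.hurwitzZeta (θ : UnitAddCircle) (k + 1) +
          HurwitzZeta.hurwitzZeta ((1 - θ : ℝ) : UnitAddCircle) (k + 1))) * Complex.Gamma ν -
      (if k = 1 then 1 else 0) / (2 * X) * Complex.Gamma (ν + 1) := by
  have hpi := Real.pi_pos
  have hκ : 0 < 4 * Real.pi ^ 2 / X := by positivity
  have hs : 0 < (ν + k + 1).re := by
    have : (ν + k + 1).re = ν.re + k + 1 := by simp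
    rw [this]; positivity
  have hν1 : 0 < (ν + 1).re := by simp; linarith
  set A : ℂ := (-1) ^ ((k + 1) / 2) / 2 * (2 * Real.pi / X) ^ (k + 1) with hA
  set B : ℂ := (-1) ^ ((k + 1) / 2) * (k.factorial : ℂ) / (2 * (2 * (Real.pi : ℂ)) ^ (k + 1)) *
        (HurwitzZeta.hurwitzZeta (θ : UnitAddCircle) (k + 1) +
          HurwitzZeta.hurwitzZeta ((1 - θ : ℝ) : UnitAddCircle) (k + 1)) with hB
  set δ : ℂ := if k = 1 then 1 else 0 with hδ
  have hi0 := integrableOn_gammaKernel hν le_rfl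
  have hi1 := integrableOn_gammaKernel hν1 le_rfl
  have key := tsum_integral_sub_tsum_integral (μ := volume.restrict (Set.Ioi (0 : ℝ)))
    (F := besselTerm k θ ν X) (G := fun p t => A * dualTerm k θ (ν + k + 1) (4 * Real.pi ^ 2 / X) p t)
    (H := fun t => -B * gammaKernel ν 0 t - δ / (2 * X) * gammaKernel (ν + 1) 0 t)
    (integrableOn_besselTerm k θ ν hX)
    (fun p => (integrableOn_dualTerm k hθ₀ hθ₁ hκ hs p).const_mul _)
    (summable_integral_norm_besselTerm k θ hν hX)
    (by
      simp only [norm_mul, integral_const_mul]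
      exact (summable_integral_norm_dualTerm k hθ₀ hθ₁ hκ hν).mul_left _)
    (by
      refine (ae_restrict_iff' measurableSet_Ioi).2 (.of_forall fun t (ht : 0 < t) => ?_)
      obtain ⟨s1, e1⟩ := summable_besselTerm k θ ν hX ht
      obtain ⟨s2, e2⟩ := summable_dualTerm k (ν + k + 1) hθ₀ hθ₁ hX ht
      refine ⟨s1, s2.mul_left _, ?_⟩
      have hw : 0 < X / (2 * Real.pi * t) := by positivity
      have ht' : (t : ℂ) ≠ 0 := by exact_mod_cast ht.ne'
      have hX' : (X : ℂ) ≠ 0 := by exact_mod_cast hX.ne'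
      have hpi' : (Real.pi : ℂ) ≠ 0 := by exact_mod_cast hpi.ne'
      have e3 : (t : ℂ) ^ (ν + k + 1 - 1) = (t : ℂ) ^ (ν - 1) * (t : ℂ) ^ (k + 1) := by
        rw [← cpow_add_natCast ht']
        congr 1
        push_cast
        ring
      have e4 : (t : ℂ) ^ (ν + 1 - 1) = (t : ℂ) ^ (ν - 1) * (t : ℂ) ^ 1 := by
        rw [← cpow_add_natCast ht']
        congr 1
        push_cast
        ring
      -- The factor w^(-k-1) supplies t^(k+1), which raises the Gamma parameter from ν to ν + k + 1.
      have e5 : (-1) ^ ((k + 1) / 2) / (2 * ((X / (2 * Real.pi * t) : ℝ) : ℂ) ^ (k + 1)) =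
          A * (t : ℂ) ^ (k + 1) := by
        rw [hA]
        push_cast
        simp only [div_pow, mul_pow]
        field_simp
      -- Likewise the δ-term gains one power of t, hence Γ(ν + 1).
      have e6 : (1 / (4 * Real.pi * ((X / (2 * Real.pi * t) : ℝ) : ℂ)) : ℂ) = t / (2 * X) := by
        push_cast
        field_simp
        norm_num
      rw [tsum_mul_left, e1, e2, lambertSum_eq hk hθ₀ hθ₁ hw, e3, e5, e6, gammaKernel, gammaKernel,
        e4]
      simp only [zero_mul, neg_zero, Real.exp_zero, Complex.ofReal_one, mul_one, pow_one]
      ring)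
  simp only [integral_besselTerm, integral_const_mul, integral_dualTerm k hθ₀ hθ₁ hκ hs,
    tsum_mul_left] at key
  rw [integral_sub (hi0.const_mul _) (hi1.const_mul _), integral_const_mul, integral_const_mul,
    integral_gammaKernel hν le_rfl, integral_gammaKernel hν1 le_rfl] at key
  simp only [zero_add, Complex.ofReal_one, Complex.one_cpow, div_one, mul_one] at key
  rw [mul_assoc A, key]

/-! ### Regrouping by divisors and the final normalisation -/

/-- Pairs (m, d) are fibred over the product n = md; J is constant on each fibre. -/
theorem hasSum_cosDivisorSum_mul {k : ℕ} {θ : ℝ} {J : ℕ → ℂ}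
    (h : Summable fun p : ℕ+ × ℕ+ => ((p.2 : ℕ) : ℂ) ^ k *
        ((Real.cos (2 * Real.pi * (p.2 : ℕ) * θ) : ℝ) : ℂ) * J ((p.1 : ℕ) * (p.2 : ℕ))) :
    HasSum (fun n : ℕ+ => J n * (cosDivisorSum k θ n : ℂ))
      (∑' p : ℕ+ × ℕ+, ((p.2 : ℕ) : ℂ) ^ k *
        ((Real.cos (2 * Real.pi * (p.2 : ℕ) * θ) : ℝ) : ℂ) * J ((p.1 : ℕ) * (p.2 : ℕ))) := by
  have h1 := (sigmaAntidiagonalEquivProd.hasSum_iff).2 h.hasSum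
  refine h1.sigma fun n => ?_
  have h2 := hasSum_fintype fun x : (n : ℕ).divisorsAntidiagonal =>
    ((x.1.2 : ℕ) : ℂ) ^ k * ((Real.cos (2 * Real.pi * x.1.2 * θ) : ℝ) : ℂ) * J (x.1.1 * x.1.2)
  have h3 : ∑ x : (n : ℕ).divisorsAntidiagonal, ((x.1.2 : ℕ) : ℂ) ^ k *
      ((Real.cos (2 * Real.pi * x.1.2 * θ) : ℝ) : ℂ) * J (x.1.1 * x.1.2) =
      J n * (cosDivisorSum k θ n : ℂ) := by
    rw [Finset.sum_coe_sort (n : ℕ).divisorsAntidiagonal fun x : ℕ × ℕ => (x.2 : ℂ) ^ k *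
      ((Real.cos (2 * Real.pi * x.2 * θ) : ℝ) : ℂ) * J (x.1 * x.2)]
    rw [Finset.sum_congr rfl fun x hx => by rw [(Nat.mem_divisorsAntidiagonal.1 hx).1],
      Nat.sum_divisorsAntidiagonal' fun _ d => (d : ℂ) ^ k *
        ((Real.cos (2 * Real.pi * d * θ) : ℝ) : ℂ) * J n, cosDivisorSum, ← Finset.sum_mul, mul_comm]
    push_cast
    rfl
  rw [h3] at h2
  exact h2

/-- The argument is 2T with T = √(nX), X = a²x/4, so n^(ν/2) cancels the n-dependence of T^(-ν). -/
theorem natCast_cpow_mul_besselK (ν : ℂ) {a x : ℝ} (ha : 0 < a) (hx : 0 < x) (n : ℕ+) :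
    ((n : ℕ) : ℂ) ^ (ν / 2) * besselK ν ((a * Real.sqrt ((n : ℕ) * x) : ℝ) : ℂ) =
      ((a ^ 2 * x / 4 : ℝ) : ℂ) ^ (-(ν / 2)) / 2 *
        macdonaldIntegral ν ((n : ℕ) * (a ^ 2 * x / 4)) := by
  have hn : (0 : ℝ) < (n : ℕ) := by exact_mod_cast n.pos
  set X : ℝ := a ^ 2 * x / 4 with hX
  have hX0 : 0 < X := by positivity
  set T : ℝ := √((n : ℕ) * X) with hT
  have hT0 : 0 < T := Real.sqrt_pos.2 (by positivity)
  have hT2 : T ^ 2 = (n : ℕ) * X := Real.sq_sqrt (by positivity)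
  have hz : a * √((n : ℕ) * x) = 2 * T := by
    have h1 : 0 ≤ a * √((n : ℕ) * x) := by positivity
    have h2 : 0 ≤ 2 * T := by positivity
    rw [← abs_of_nonneg h1, ← abs_of_nonneg h2, ← sq_eq_sq_iff_abs_eq_abs, mul_pow, mul_pow, hT2,
      Real.sq_sqrt (by positivity), hX]
    ring
  have hlog : Real.log T = (Real.log (n : ℕ) + Real.log X) / 2 := by
    rw [hT, Real.log_sqrt (by positivity), Real.log_mul hn.ne' hX0.ne']
  have e : ((n : ℕ) : ℂ) ^ (ν / 2) * (T : ℂ) ^ (-ν) = (X : ℂ) ^ (-(ν / 2)) := by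
    rw [← Complex.ofReal_natCast, ofReal_cpow_eq_exp hn, ofReal_cpow_eq_exp hT0,
      ofReal_cpow_eq_exp hX0, ← Complex.exp_add, hlog]
    congr 1
    push_cast
    ring
  rw [hz, besselK_eq_macdonaldIntegral ν hT0, hT2, ← e]
  ring

theorem theorem2p7 (k : ℕ) (hk : Odd k) (ν : ℂ) (hν : 0 < ν.re) (a x θ : ℝ)
    (ha : 0 < a) (hx : 0 < x) (hθ₀ : 0 < θ) (hθ₁ : θ < 1) :
    Summable (fun n : ℕ+ => ((n : ℕ) : ℂ) ^ (ν / 2) *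
      besselK ν ((a * Real.sqrt ((n : ℕ) * x) : ℝ) : ℂ) * (cosDivisorSum k θ n : ℂ)) ∧
    Summable (fun p : ℕ+ × ℕ => (((p.1 : ℕ) : ℂ)) ^ k *
      (1 / ((16 * Real.pi ^ 2 / a ^ 2 * ((p.1 : ℕ) * (p.2 + θ) / x) + 1 : ℝ) : ℂ) ^ (ν + k + 1) +
       1 / ((16 * Real.pi ^ 2 / a ^ 2 * ((p.1 : ℕ) * (p.2 + 1 - θ) / x) + 1 : ℝ) : ℂ) ^
        (ν + k + 1))) ∧
    ((a ^ 2 * x / 4 : ℝ) : ℂ) ^ (ν / 2 + k + 1) *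
      ∑' n : ℕ+, ((n : ℕ) : ℂ) ^ (ν / 2) *
        besselK ν ((a * Real.sqrt ((n : ℕ) * x) : ℝ) : ℂ) * (cosDivisorSum k θ n : ℂ) =
      (-1) ^ ((k - 1) / 2) * (a : ℂ) ^ (2 * k + 2) * (k.factorial : ℂ) /
          (2 ^ (2 * k + 4) * (2 * (Real.pi : ℂ)) ^ (k + 1)) * Complex.Gamma ν *
          (HurwitzZeta.hurwitzZeta (θ : UnitAddCircle) (k + 1) +
            HurwitzZeta.hurwitzZeta ((1 - θ : ℝ) : UnitAddCircle) (k + 1)) * (x : ℂ) ^ (k + 1) +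
        (-1) ^ ((k + 1) / 2) * (2 * (Real.pi : ℂ)) ^ (k + 1) * Complex.Gamma (ν + k + 1) / 4 *
          ∑' d : ℕ+, ((d : ℕ) : ℂ) ^ k * ∑' m : ℕ,
            (1 / ((16 * Real.pi ^ 2 / a ^ 2 * ((d : ℕ) * (m + θ) / x) + 1 : ℝ) : ℂ) ^
                (ν + k + 1) +
             1 / ((16 * Real.pi ^ 2 / a ^ 2 * ((d : ℕ) * (m + 1 - θ) / x) + 1 : ℝ) : ℂ) ^
                (ν + k + 1)) -
        (if k = 1 then 1 else 0) * ((a : ℂ) ^ 2 / 16) * Complex.Gamma (1 + ν) * (x : ℂ) := by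
  have hX : 0 < a ^ 2 * x / 4 := by positivity
  have hpi := Real.pi_pos
  have hκ : 0 < 4 * Real.pi ^ 2 / (a ^ 2 * x / 4) := by positivity
  have hF : Summable fun p : ℕ+ × ℕ+ => ((p.2 : ℕ) : ℂ) ^ k *
        ((Real.cos (2 * Real.pi * (p.2 : ℕ) * θ) : ℝ) : ℂ) *
        macdonaldIntegral ν ((((p.1 : ℕ) * (p.2 : ℕ) : ℕ) : ℝ) * (a ^ 2 * x / 4)) := by
    have h : Summable fun p =>
        ∫ t in Set.Ioi (0 : ℝ), besselTerm k θ ν (a ^ 2 * x / 4) p t :=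
      (summable_integral_norm_besselTerm k θ hν hX).of_norm_bounded
      fun p => MeasureTheory.norm_integral_le_integral_norm _
    refine h.congr fun p => ?_
    rw [integral_besselTerm]
    push_cast
    rfl
  have hsum := hasSum_cosDivisorSum_mul
    (J := fun n => macdonaldIntegral ν ((n : ℝ) * (a ^ 2 * x / 4))) hF
  have hterm : ∀ n : ℕ+, ((n : ℕ) : ℂ) ^ (ν / 2) *
      besselK ν ((a * Real.sqrt ((n : ℕ) * x) : ℝ) : ℂ) * (cosDivisorSum k θ n : ℂ) =
      ((a ^ 2 * x / 4 : ℝ) : ℂ) ^ (-(ν / 2)) / 2 *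
        (macdonaldIntegral ν ((n : ℕ) * (a ^ 2 * x / 4)) * (cosDivisorSum k θ n : ℂ)) := by
    intro n
    rw [natCast_cpow_mul_besselK ν ha hx, mul_assoc]
  have hsum' := (hsum.mul_left (((a ^ 2 * x / 4 : ℝ) : ℂ) ^ (-(ν / 2)) / 2)).congr_fun hterm
  have hκ₁ : ∀ y : ℝ, 16 * Real.pi ^ 2 / a ^ 2 * (y / x) =
      4 * Real.pi ^ 2 / (a ^ 2 * x / 4) * y := by
    intro y
    field_simp
    ring
  have hdual : Summable (fun p : ℕ+ × ℕ => (((p.1 : ℕ) : ℂ)) ^ k *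
      (1 / ((16 * Real.pi ^ 2 / a ^ 2 * ((p.1 : ℕ) * (p.2 + θ) / x) + 1 : ℝ) : ℂ) ^ (ν + k + 1) +
       1 / ((16 * Real.pi ^ 2 / a ^ 2 * ((p.1 : ℕ) * (p.2 + 1 - θ) / x) + 1 : ℝ) : ℂ) ^
        (ν + k + 1))) := by
    have h1 := summable_pow_div_mul_add_one_cpow k hθ₀ hκ hν
    have h2 := summable_pow_div_mul_add_one_cpow k (sub_pos.2 hθ₁) hκ hν
    refine (h1.add h2).congr fun p => ?_
    rw [hκ₁, hκ₁, ← mul_add, add_sub_assoc]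
  refine ⟨hsum'.summable, hdual, ?_⟩
  have key := tsum_macdonaldIntegral_sub hk hν hθ₀ hθ₁ hX
  simp only [← hκ₁] at key
  rw [hdual.tsum_prod] at key
  simp only [tsum_mul_left] at key
  rw [hsum'.tsum_eq]
  simp only [Nat.cast_mul]
  set D := ∑' d : ℕ+, ((d : ℕ) : ℂ) ^ k * ∑' m : ℕ,
    (1 / ((16 * Real.pi ^ 2 / a ^ 2 * ((d : ℕ) * (m + θ) / x) + 1 : ℝ) : ℂ) ^ (ν + k + 1) +
     1 / ((16 * Real.pi ^ 2 / a ^ 2 * ((d : ℕ) * (m + 1 - θ) / x) + 1 : ℝ) : ℂ) ^ (ν + k + 1))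
  set S := ∑' p : ℕ+ × ℕ+, ((p.2 : ℕ) : ℂ) ^ k *
    ((Real.cos (2 * Real.pi * (p.2 : ℕ) * θ) : ℝ) : ℂ) *
    macdonaldIntegral ν ((p.1 : ℕ) * (p.2 : ℕ) * (a ^ 2 * x / 4))
  set H := HurwitzZeta.hurwitzZeta (θ : UnitAddCircle) (k + 1) +
    HurwitzZeta.hurwitzZeta ((1 - θ : ℝ) : UnitAddCircle) (k + 1)
  have hX' : ((a ^ 2 * x / 4 : ℝ) : ℂ) ≠ 0 := by exact_mod_cast hX.ne'
  have ha' : (a : ℂ) ≠ 0 := by exact_mod_cast ha.ne'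
  have hx' : (x : ℂ) ≠ 0 := by exact_mod_cast hx.ne'
  have hpi' : (Real.pi : ℂ) ≠ 0 := by exact_mod_cast hpi.ne'
  have hpow : ((a ^ 2 * x / 4 : ℝ) : ℂ) ^ (ν / 2 + k + 1) *
      (((a ^ 2 * x / 4 : ℝ) : ℂ) ^ (-(ν / 2)) / 2 * S) =
      ((a : ℂ) ^ 2 * x / 4) ^ (k + 1) / 2 * S := by
    have e : ((a ^ 2 * x / 4 : ℝ) : ℂ) ^ (ν / 2 + k + 1) *
        ((a ^ 2 * x / 4 : ℝ) : ℂ) ^ (-(ν / 2)) = ((a : ℂ) ^ 2 * x / 4) ^ (k + 1) := by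
      rw [← Complex.cpow_add _ _ hX']
      have : ν / 2 + k + 1 + -(ν / 2) = ((k + 1 : ℕ) : ℂ) := by push_cast; ring
      rw [this, Complex.cpow_natCast]
      push_cast
      rfl
    rw [← e]
    ring
  rw [hpow, sub_eq_iff_eq_add.1 key]
  have hsign : ((-1 : ℂ)) ^ ((k + 1) / 2) = -(-1) ^ ((k - 1) / 2) := by
    obtain ⟨j, rfl⟩ := hk
    have h1 : (2 * j + 1 + 1) / 2 = j + 1 := by omega
    have h2 : (2 * j + 1 - 1) / 2 = j := by omega
    rw [h1, h2, pow_succ]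
    ring
  have e1 : ((a : ℂ) ^ 2 * x / 4) ^ (k + 1) / 2 * (-((-1) ^ ((k + 1) / 2) * (k.factorial : ℂ) /
      (2 * (2 * (Real.pi : ℂ)) ^ (k + 1)) * H) * Complex.Gamma ν) =
      (-1) ^ ((k - 1) / 2) * (a : ℂ) ^ (2 * k + 2) * (k.factorial : ℂ) /
          (2 ^ (2 * k + 4) * (2 * (Real.pi : ℂ)) ^ (k + 1)) * Complex.Gamma ν * H *
            (x : ℂ) ^ (k + 1) := by
    have h4 : (2 : ℂ) ^ (2 * k + 4) = 4 * 4 ^ (k + 1) := by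
      rw [show 2 * k + 4 = 2 * (k + 1) + 2 by ring, pow_add, pow_mul]; norm_num; ring
    rw [hsign, h4, show 2 * k + 2 = 2 * (k + 1) by ring, div_pow, mul_pow, ← pow_mul]
    field_simp
    ring
  -- The prefactor X^(k+1) cancels the power of X in front of the dual series.
  have e2 : ((a : ℂ) ^ 2 * x / 4) ^ (k + 1) * (2 * Real.pi / ((a ^ 2 * x / 4 : ℝ) : ℂ)) ^ (k + 1) =
      (2 * (Real.pi : ℂ)) ^ (k + 1) := by
    rw [← mul_pow]
    congr 1
    push_cast
    field_simp
  have e3 : ((a : ℂ) ^ 2 * x / 4) ^ (k + 1) / 2 * ((if k = 1 then 1 else 0) /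
      (2 * ((a ^ 2 * x / 4 : ℝ) : ℂ)) * Complex.Gamma (ν + 1)) =
      (if k = 1 then 1 else 0) * ((a : ℂ) ^ 2 / 16) * Complex.Gamma (1 + ν) * (x : ℂ) := by
    split_ifs with hk1
    · subst hk1
      rw [add_comm 1 ν]
      push_cast
      field_simp
      ring
    · simp
  linear_combination e1 - e3 + (-1) ^ ((k + 1) / 2) / 4 * Complex.Gamma (ν + k + 1) * D * e2
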